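/- Let $S=\{a_0,a_1,a_2,x,y,b,c,d\}$. A sequence $w=(A_n)_{n\in\mathbb Z}$ of non-empty subsets of $S$ with $A_n\cap A_{n+1}=\emptyset$ for all $n$ is viewed as the graph with vertex set $\mathbb Z$ in which $n$ and $n+1$ are connected by $|A_n|$ edges labeled by the elements of $A_n$ (all other labels give loops); each $h\in S$ acts on its vertices by $h(n)=n+1$ if $h\in A_n$, $h(n)=n-1$ if $h\in A_{n-1}$, and $h(n)=n$ otherwise. Put $e_n=\{b,c\},\{d,b\},\{c,d\}$ for $n\equiv 1,2,0\pmod 3$, respectively. Let $\alpha=(\alpha_0,\alpha_1,\ldots)$ be a sequence whose terms are the symbol $\sigma$ or non-empty words over $\{x,y\}$. Define finite sequences of subsets of $S$ by $I_0=\{a_0\}\{a_1\}$, $J_0=\{a_0\}\{a_2\}$, $I_{n+1}=J_ne_nJ_n^{-1}$ and \[J_{n+1}=\begin{cases}J_n\{x\}I_n\{y\}I_n\{y\}J_n^{-1} & \text{if }\alpha_n=\sigma,\\ J_ne_1I_n\{t_1\}I_n\{t_2\}\cdots I_n\{t_m\}J_n^{-1} & \text{if }\alpha_n=t_1t_2\ldots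 t_m,\end{cases}\] where $u^{-1}$ denotes $u$ written in the opposite direction. Let $\mathcal S_\alpha$ be the set of all bi-infinite sequences all of whose finite segments are segments of some $I_n$ or $J_n$, $n\ge 0$ (all of them satisfy $A_n\cap A_{n+1}=\emptyset$), and let $G_\alpha$ be the group of permutations of the vertices of the graphs belonging to $\mathcal S_\alpha$ generated by the elements of $S$. Then, for every sequence $\alpha$, the derived subgroup $G_\alpha'$ is simple and has finite index in $G_\alpha$; in particular, $G_\alpha$ is virtually simple. If, moreover, each of the letters $x$ and $y$ is used infinitely often in $\alpha$ (that is, for each $z\in\{x,y\}$ there are infinitely many $n$ such that $\alpha_n=\sigma$ or $\alpha_n$ is a word containing $z$), then $G_\alpha/G_\alpha'\cong(\mathbb Z/2\mathbb Z)^4$. -/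

import Mathlib

namespace LinearGraph

/-! ### Linear graphs, subshifts and the groups they define -/

variable {S : Type}

/-- A bi-infinite sequence `(A_n)` of non-empty subsets of `S` is admissible if consecutive
terms are disjoint. It is seen as a graph on `ℤ`: the edges connecting `n` and `n + 1` are labeled
by the elements of `A_n`, and all the other labels give loops. -/
def Admissible (w : ℤ → Finset S) : Prop :=
  ∀ n, (w n).Nonempty ∧ Disjoint (w n) (w (n + 1))

/-- The segment `(A_i, A_{i+1}, …, A_{i+k-1})` of a sequence. -/
def subword (w : ℤ → Finset S) (i : ℤ) (k : ℕ) : List (Finset S) :=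
  (List.range k).map fun j => w (i + (j : ℤ))

/-- The subshift generated by a set `W` of finite words: the bi-infinite sequences
all of whose finite segments are segments (contiguous subwords) of elements of `W`. -/
def subshift (W : Set (List (Finset S))) : Set (ℤ → Finset S) :=
  {w | ∀ (i : ℤ) (k : ℕ), ∃ u ∈ W, subword w i k <:+: u}

variable [DecidableEq S]

/-- The action of a label `h` on the vertex `n` of the graph of `w`. -/
def step (w : ℤ → Finset S) (h : S) (n : ℤ) : ℤ :=
  if h ∈ w n then n + 1 else if h ∈ w (n - 1) then n - 1 else n

theorem step_involutive {w : ℤ → Finset S} (hw : Admissible w) (h : S) :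
    Function.Involutive (step w h) := by
  intro n
  have key : ∀ m, h ∈ w m → h ∉ w (m + 1) := fun m h1 h2 =>
    Finset.disjoint_left.mp (hw m).2 h1 h2
  unfold step
  by_cases h1 : h ∈ w n
  · have h2 := key n h1
    simp [h1, h2]
  · by_cases h3 : h ∈ w (n - 1)
    · simp [h1, h3]
    · simp [h1, h3]

/-- The permutation defined by a label `h` on the set of vertices of the disjoint union
of the graphs of the sequences belonging to `X`. -/
def labelPerm (X : Set (ℤ → Finset S)) (hX : ∀ w ∈ X, Admissible w) (h : S) :
    Equiv.Perm (X × ℤ) :=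
  Function.Involutive.toPerm (fun p : X × ℤ => (p.1, step p.1.1 h p.2)) (by
    rintro ⟨w, n⟩
    exact Prod.ext rfl (step_involutive (hX w.1 w.2) h n))

/-- The group defined by a set of admissible sequences (in particular, by a subshift): the group of
permutations of the vertices of all its graphs generated by the labels. -/
def definedGroup (X : Set (ℤ → Finset S)) (hX : ∀ w ∈ X, Admissible w) :
    Subgroup (Equiv.Perm (X × ℤ)) :=
  Subgroup.closure (Set.range (labelPerm X hX))

end LinearGraph

namespace AlphaGroup

open LinearGraph

/-! ### The substitutions -/

/-- The eight generators. -/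
inductive Gen
  | a0 | a1 | a2 | x | y | b | c | d
  deriving DecidableEq

/-- The letters of the words over `{x, y}`. -/
inductive Letter
  | x | y

/-- A letter as a generator. -/
def Letter.toGen : Letter → Gen
  | .x => .x
  | .y => .y

/-- The terms of a sequence `α`: the symbol `σ`, or a non-trivial element of the free monoid
`{x, y}^*`. -/
inductive Symb
  | sigma
  | word (t : List Letter) (ht : t ≠ [])

/-- The letter `z` is used by the rule of the given symbol (the rule of `σ` uses both). -/
def Symb.Uses (z : Letter) : Symb → Prop
  | .sigma => True
  | .word t _ => z ∈ t

/-- The connectors `e_n`, with indices modulo `3`: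
`e_1 = {b, c}`, `e_2 = {d, b}`, `e_3 = e_0 = {c, d}`. -/
def conn (n : ℕ) : Finset Gen :=
  if n % 3 = 1 then {.b, .c} else if n % 3 = 2 then {.d, .b} else {.c, .d}

/-- The pair `(I_n, J_n)` of segments of the `n`th generation. -/
def IJ (α : ℕ → Symb) : ℕ → List (Finset Gen) × List (Finset Gen)
  | 0 => ([{.a0}, {.a1}], [{.a0}, {.a2}])
  | n + 1 =>
    let I := (IJ α n).1
    let J := (IJ α n).2
    (J ++ [conn n] ++ J.reverse,
      match α n with
      | .sigma => J ++ [{.x}] ++ I ++ [{.y}] ++ I ++ [{.y}] ++ J.reverse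
      | .word t _ => J ++ [conn 1] ++ t.flatMap (fun z => I ++ [{z.toGen}]) ++ J.reverse)

/-- The subshift defined by the set `{I_n, J_n}_{n ≥ 0}`. -/
def shift (α : ℕ → Symb) : Set (ℤ → Finset Gen) :=
  subshift {u | ∃ n, u = (IJ α n).1 ∨ u = (IJ α n).2}

/-! The sequences of the subshift are admissible. -/

/-- Non-empty sets with consecutive ones disjoint, the first and the last one consisting of
letters `a_i`. -/
def Good (l : List (Finset Gen)) : Prop :=
  l.IsChain Disjoint ∧ (∀ A ∈ l, A.Nonempty) ∧ l ≠ [] ∧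
    (∀ A ∈ l.head?, A ⊆ {.a0, .a1, .a2}) ∧ ∀ A ∈ l.getLast?, A ⊆ {.a0, .a1, .a2}

theorem Good.reverse {l : List (Finset Gen)} (h : Good l) : Good l.reverse := by
  obtain ⟨h1, h2, h3, h4, h5⟩ := h
  refine ⟨?_, by simpa using h2, by simpa using h3, by simpa using h5, by simpa using h4⟩
  rw [List.isChain_reverse]
  exact h1.imp fun _ _ h => h.symm

theorem Good.append {l m : List (Finset Gen)} {e : Finset Gen} (hl : Good l) (hm : Good m)
    (he : e.Nonempty) (hd : Disjoint e {.a0, .a1, .a2}) : Good (l ++ [e] ++ m) := by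
  obtain ⟨h1, h2, h3, h4, h5⟩ := hl
  obtain ⟨k1, k2, k3, k4, k5⟩ := hm
  refine ⟨?_, ?_, by simp, ?_, ?_⟩
  · rw [List.append_assoc, List.isChain_append]
    refine ⟨h1, ?_, ?_⟩
    · rw [List.isChain_append]
      refine ⟨by simp, k1, ?_⟩
      intro A hA B hB
      simp only [List.getLast?_singleton, Option.mem_some_iff] at hA
      subst hA
      exact hd.mono_right (k4 B hB)
    · intro A hA B hB
      simp only [List.singleton_append, List.head?_cons, Option.mem_some_iff] at hB
      subst hB
      exact (hd.mono_right (h5 A hA)).symm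
  · intro A hA
    simp only [List.mem_append, List.mem_singleton] at hA
    rcases hA with (hA | rfl) | hA
    · exact h2 A hA
    · exact he
    · exact k2 A hA
  · intro A hA
    apply h4
    rw [List.append_assoc, List.head?_append_of_ne_nil _ h3] at hA
    exact hA
  · intro A hA
    apply k5
    rw [List.getLast?_append_of_ne_nil _ k3] at hA
    exact hA

theorem conn_good (n : ℕ) :
    (conn n).Nonempty ∧ Disjoint (conn n) ({.a0, .a1, .a2} : Finset Gen) := by
  unfold conn
  split_ifs <;> decide

theorem flatMap_good {I J : List (Finset Gen)} (hI : Good I) :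
    ∀ (t : List Letter) (P : List (Finset Gen)) (e : Finset Gen), Good P → Good J → e.Nonempty →
      Disjoint e {.a0, .a1, .a2} →
      Good (P ++ [e] ++ t.flatMap (fun z => I ++ [{z.toGen}]) ++ J) := by
  intro t
  induction t with
  | nil =>
    intro P e hP hJ he hd
    simpa using hP.append hJ he hd
  | cons z t ih =>
    intro P e hP hJ he hd
    have h := ih (P ++ [e] ++ I) {z.toGen} (hP.append hI he hd) hJ (by simp)
      (by cases z <;> decide)
    simpa using h

theorem IJ_good (α : ℕ → Symb) : ∀ n, Good (IJ α n).1 ∧ Good (IJ α n).2 := by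
  intro n
  induction n with
  | zero =>
    refine ⟨⟨?_, ?_, ?_, ?_, ?_⟩, ⟨?_, ?_, ?_, ?_, ?_⟩⟩ <;> simp [IJ]
  | succ n ih =>
    obtain ⟨hI, hJ⟩ := ih
    refine ⟨hJ.append hJ.reverse (conn_good n).1 (conn_good n).2, ?_⟩
    simp only [IJ]
    split
    · exact ((hJ.append hI (by simp) (by decide)).append hI (by simp) (by decide)).append
        hJ.reverse (by simp) (by decide)
    · exact flatMap_good hI _ _ _ hJ hJ.reverse (conn_good 1).1 (conn_good 1).2

theorem shift_admissible (α : ℕ → Symb) : ∀ w ∈ shift α, Admissible w := by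
  intro w hw n
  obtain ⟨u, hu, hseg⟩ := hw n 2
  have hg : Good u := by
    obtain ⟨m, rfl | rfl⟩ := hu
    · exact (IJ_good α m).1
    · exact (IJ_good α m).2
  have hs : subword w n 2 = [w n, w (n + 1)] := by
    simp [subword, List.range_succ]
  rw [hs] at hseg
  refine ⟨hg.2.1 _ (hseg.subset (by simp)), ?_⟩
  have := hg.1.infix hseg
  simpa using this

/-- The group `G_α`. -/
def G (α : ℕ → Symb) : Subgroup (Equiv.Perm (shift α × ℤ)) :=
  definedGroup (shift α) (shift_admissible α)

end AlphaGroup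

/-!
The group is studied through the action of the free group `F` on the generators on the vertices of
the graphs of the sequences of the subshift, and of the blocks `I_n`, `J_n` seen as isolated finite
segments. Every sequence of the subshift locally looks like a concatenation of blocks of
generation `n`, and an element of `F` is *local* in generation `n` (`Local`) if it maps each placed
block to itself and acts there as on the block alone. The generators `a_i` are local in all
generations, and an element local in generation `n` is local in all later ones.

**Local alternating groups** (`swapFull_real`). For `n ≥ 1` each even permutation of the vertices
of `J_n` is induced by a local element acting trivially on `I_n`. In `J_{n+1}` the last connector is
a letter `z` between a copy of `I_n` and a copy of `J_n`. If a local element acts trivially on `I_n`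
and moves the last vertex of `J_n`, but no other vertex moved by `z`, then its commutator with `z`
is local in generation `n + 1`, acts trivially on `I_{n+1}`, and is a cycle of length three on
`J_{n+1}`. Conjugation by generators spreads this cycle from a short interval to the whole block.
By perfectness of the alternating group such elements may be taken in the derived subgroup of `F`.

**Parity** (`Local.mem_of_swapFull`). A local element acts in the same way on the two copies
of `J_n` in `I_{n+1}`, hence evenly on `I_{n+1}`. In `J_{n+2}` there are two copies of `J_{n+1}`,
and all the other blocks are copies of `I_{n+1}`, so that the action on `J_{n+2}` is even as well.
It follows that modulo the kernel of the action every local element is a product of elements of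
the local alternating groups of arbitrarily big generations.

**Simplicity** (`commutator_le_of_normal`). Let `M` be a subgroup of `F` which contains the kernel
of the action, is normalized by the derived subgroup, and contains an element `f` acting
non-trivially. Then `f` moves a vertex deep inside of `J_m` for all big `m`. Commutators with
local elements give a cycle of length three on `J_m` in `M`, so that `M` contains the local
alternating groups of all big generations, and therefore all local elements, among them the `a_i`.
The same is true for the conjugates of `M`, hence the `a_i` belong to the normal core of `M`. Since
the other generators commute with each other, the core contains the derived subgroup.

**Abelianization.** By the same argument the `a_i` belong to the derived subgroup. Together with the
relations `h ^ 2 = 1` and `bcd = 1` this gives a surjection from `(ℤ/2ℤ)^4` onto the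
abelianization. For each connector `A` appearing infinitely often the subshift contains
the symmetric sequence `… J_n^{-1} A J_n …` (`symSeq`). The action on it commutes with its
reflection, and the parity of the number of vertices moved across the axis of symmetry is
a homomorphism to `ℤ/2ℤ` which counts the letters belonging to `A`, as only these move a vertex
across the axis. Four such homomorphisms show that the surjection is injective, if `x` and `y` are
used infinitely often.
-/

namespace LinearGraph

open Equiv

/-! ### Sequences of disjoint sets and finite words -/

section Sequences

variable {S : Type}

/-- Consecutive terms are disjoint. Empty terms are allowed, so that finite words, continued by
empty sets, are covered as well. -/
def Disj (w : ℤ → Finset S) : Prop :=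
  ∀ n, Disjoint (w n) (w (n + 1))

theorem Admissible.disj {w : ℤ → Finset S} (hw : Admissible w) : Disj w := fun n => (hw n).2

theorem Disj.notMem {w : ℤ → Finset S} (hw : Disj w) {n : ℤ} {h : S} (h1 : h ∈ w n) :
    h ∉ w (n + 1) := fun h2 => Finset.disjoint_left.mp (hw n) h1 h2

theorem Disj.notMem' {w : ℤ → Finset S} (hw : Disj w) {n : ℤ} {h : S} (h1 : h ∈ w n) :
    h ∉ w (n - 1) := fun h2 => by
  have := hw.notMem h2
  rw [sub_add_cancel] at this
  exact this h1

/-- The induction principle `FreeGroup.induction_on`, with `FreeGroup.of` in place of `pure`. -/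
theorem freeGroup_induction {C : FreeGroup S → Prop} (one : C 1) (of : ∀ h, C (FreeGroup.of h))
    (inv : ∀ h, C (FreeGroup.of h) → C (FreeGroup.of h)⁻¹)
    (mul : ∀ f g, C f → C g → C (f * g)) (f : FreeGroup S) : C f :=
  FreeGroup.induction_on f one of inv mul

/-- The position on the line of the vertex `p` of a graph placed at `s`, in the direct or,
if `r` is true, in the opposite direction. -/
def vert (s : ℤ) (r : Bool) (p : ℤ) : ℤ :=
  if r then s - p else s + p

/-- The sequence `w` seen from the vertex `s`, in the direct or in the opposite direction. -/
def view (w : ℤ → Finset S) (s : ℤ) (r : Bool) (p : ℤ) : Finset S :=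
  if r then w (s - p - 1) else w (s + p)

theorem vert_vert (s r s' r' p) :
    vert s r (vert s' r' p) = vert (vert s r s') (xor r r') p := by
  cases r <;> cases r' <;> simp [vert] <;> ring

theorem vert_injective (s : ℤ) (r : Bool) : Function.Injective (vert s r) := by
  intro p q h
  cases r <;> simpa [vert] using h

theorem view_view (w : ℤ → Finset S) (s r s' r') :
    view (view w s r) s' r' = view w (vert s r s') (xor r r') := by
  funext p
  cases r <;> cases r' <;> simp [vert, view] <;> congr 1 <;> ring

theorem Disj.view {w : ℤ → Finset S} (hw : Disj w) (s : ℤ) (r : Bool) : Disj (view w s r) := by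
  intro n
  cases r
  · simpa [LinearGraph.view, add_assoc] using hw (s + n)
  · have := (hw (s - (n + 1) - 1)).symm
    simp only [LinearGraph.view, if_true]
    convert this using 2
    ring

/-- A finite word, continued by empty sets to a bi-infinite sequence. Its graph is a finite segment
together with isolated vertices. -/
def ofList (u : List (Finset S)) : ℤ → Finset S
  | Int.ofNat n => u.getD n ∅
  | Int.negSucc _ => ∅

/-- The word `u` is read in the sequence `w` starting from the place `p`. -/
def Reads (w : ℤ → Finset S) : ℤ → List (Finset S) → Prop
  | _, [] => True
  | p, A :: u => w p = A ∧ Reads w (p + 1) u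

theorem reads_append {w : ℤ → Finset S} {u v : List (Finset S)} : ∀ {p : ℤ},
    Reads w p (u ++ v) ↔ Reads w p u ∧ Reads w (p + u.length) v := by
  induction u with
  | nil => simp [Reads]
  | cons A u ih =>
    intro p
    simp only [List.cons_append, Reads, ih, and_assoc, List.length_cons]
    push_cast
    rw [add_assoc, add_comm 1 (u.length : ℤ)]

theorem reads_singleton {w : ℤ → Finset S} {A : Finset S} {p : ℤ} : Reads w p [A] ↔ w p = A := by
  simp [Reads]

theorem reads_iff {w : ℤ → Finset S} {u : List (Finset S)} : ∀ {p : ℤ},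
    Reads w p u ↔ ∀ i : ℕ, i < u.length → w (p + i) = u.getD i ∅ := by
  induction u with
  | nil => simp [Reads]
  | cons A u ih =>
    intro p
    simp only [Reads, ih]
    constructor
    · rintro ⟨h1, h2⟩ (_ | i) hi
      · simpa using h1
      · have := h2 i (by simpa using hi)
        simp only [List.getD_cons_succ]
        rw [← this]; congr 1; push_cast; ring
    · intro h
      refine ⟨by simpa using h 0 (by simp), fun i hi => ?_⟩
      have := h (i + 1) (by simpa using hi)
      simp only [List.getD_cons_succ] at this
      rw [← this]; congr 1; push_cast; ring

theorem reads_view {w : ℤ → Finset S} {u : List (Finset S)} {s p : ℤ} :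
    Reads (view w s false) p u ↔ Reads w (s + p) u := by
  simp only [reads_iff, view, Bool.false_eq_true, if_false, add_assoc]

theorem reads_view_reverse {w : ℤ → Finset S} {u : List (Finset S)} {s : ℤ} :
    Reads (view w s true) 0 u ↔ Reads w (s - u.length) u.reverse := by
  simp only [reads_iff, view, if_true, List.length_reverse]
  constructor
  · intro h i hi
    have := h (u.length - 1 - i) (by omega)
    rw [List.getD_eq_getElem _ _ (by simpa using hi), List.getElem_reverse]
    rw [List.getD_eq_getElem _ _ (by omega)] at this
    rw [← this]
    congr 1
    omega
  · intro h i hi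
    have := h (u.length - 1 - i) (by omega)
    rw [List.getD_eq_getElem _ _ (by simp; omega), List.getElem_reverse] at this
    rw [List.getD_eq_getElem _ _ hi]
    have e : u.length - 1 - (u.length - 1 - i) = i := by omega
    simp only [e] at this
    rw [← this]
    congr 1
    omega

theorem ofList_natCast (u : List (Finset S)) (n : ℕ) : ofList u (n : ℤ) = u.getD n ∅ := rfl

theorem ofList_of_neg (u : List (Finset S)) {p : ℤ} (hp : p < 0) : ofList u p = ∅ := by
  obtain ⟨n, rfl⟩ := Int.eq_negSucc_of_lt_zero hp
  rfl

theorem ofList_of_ge (u : List (Finset S)) {p : ℤ} (hp : (u.length : ℤ) ≤ p) : ofList u p = ∅ := by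
  lift p to ℕ using by omega
  rw [ofList_natCast, List.getD_eq_default _ _ (by omega)]

theorem reads_ofList (u : List (Finset S)) : Reads (ofList u) 0 u := by
  rw [reads_iff]
  intro i _
  rw [zero_add, ofList_natCast]

theorem Reads.eq_ofList {w : ℤ → Finset S} {u : List (Finset S)} (h : Reads w 0 u) {p : ℤ}
    (h0 : 0 ≤ p) (h1 : p < u.length) : w p = ofList u p := by
  lift p to ℕ using h0
  rw [reads_iff] at h
  have := h p (by omega)
  rw [zero_add] at this
  rw [this, ofList_natCast]

theorem disj_ofList {u : List (Finset S)} (h : u.IsChain Disjoint) : Disj (ofList u) := by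
  intro p
  rcases lt_or_ge p 0 with hp | hp
  · simp [ofList_of_neg u hp]
  rcases lt_or_ge (p + 1) u.length with h1 | h1
  · lift p to ℕ using hp
    have h2 : p + 1 < u.length := by omega
    rw [show (p : ℤ) + 1 = ((p + 1 : ℕ) : ℤ) by push_cast; ring, ofList_natCast, ofList_natCast,
      List.getD_eq_getElem _ _ (by omega), List.getD_eq_getElem _ _ h2]
    exact List.isChain_iff_getElem.mp h p h2
  · simp [ofList_of_ge u h1]

end Sequences

/-! ### The action of the free group on the vertices of a graph -/

section Action

variable {S : Type} [DecidableEq S]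

theorem Disj.step_involutive {w : ℤ → Finset S} (hw : Disj w) (h : S) :
    Function.Involutive (step w h) := by
  intro n
  have key : ∀ m, h ∈ w m → h ∉ w (m + 1) := fun m h1 => hw.notMem h1
  unfold step
  by_cases h1 : h ∈ w n
  · have h2 := key n h1
    simp [h1, h2]
  · by_cases h3 : h ∈ w (n - 1)
    · simp [h1, h3]
    · simp [h1, h3]

theorem step_of_notMem {w : ℤ → Finset S} {h : S} {n : ℤ} (h1 : h ∉ w n) (h2 : h ∉ w (n - 1)) :
    step w h n = n := by
  simp [step, h1, h2]

theorem step_of_mem {w : ℤ → Finset S} {h : S} {n : ℤ} (h1 : h ∈ w n) :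
    step w h n = n + 1 := by
  simp [step, h1]

theorem step_of_mem_pred {w : ℤ → Finset S} (hw : Disj w) {h : S} {n : ℤ} (h1 : h ∈ w (n - 1)) :
    step w h n = n - 1 := by
  have := hw.notMem h1
  rw [sub_add_cancel] at this
  simp [step, h1, this]

theorem step_congr {w w' : ℤ → Finset S} {h : S} {n : ℤ} (h1 : w n = w' n)
    (h2 : w (n - 1) = w' (n - 1)) : step w h n = step w' h n := by
  simp [step, h1, h2]

open Classical in
/-- The permutation of `ℤ` defined by a label, with the junk value `1` if some consecutive terms
of `w` are not disjoint. -/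
noncomputable def edgePerm (w : ℤ → Finset S) (h : S) : Perm ℤ :=
  if H : Disj w then Function.Involutive.toPerm (step w h) (H.step_involutive h) else 1

/-- The action of the free group on the vertices of the graph of `w`. -/
noncomputable def rho (w : ℤ → Finset S) : FreeGroup S →* Perm ℤ :=
  FreeGroup.lift (edgePerm w)

theorem rho_of {w : ℤ → Finset S} (hw : Disj w) (h : S) (n : ℤ) :
    rho w (FreeGroup.of h) n = step w h n := by
  simp [rho, edgePerm, hw]

theorem rho_of_inv {w : ℤ → Finset S} (hw : Disj w) (h : S) :
    rho w (FreeGroup.of h)⁻¹ = rho w (FreeGroup.of h) := by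
  rw [map_inv, inv_eq_iff_mul_eq_one]
  ext n
  simp [rho_of hw, hw.step_involutive h n]

theorem step_view {w : ℤ → Finset S} (hw : Disj w) (s : ℤ) (r : Bool) (h : S) (p : ℤ) :
    vert s r (step (view w s r) h p) = step w h (vert s r p) := by
  cases r
  · simp only [vert, view, step, Bool.false_eq_true, if_false]
    rw [show s + (p - 1) = s + p - 1 by ring]
    split_ifs <;> ring
  · simp only [vert, view, step, if_true]
    rw [show s - (p - 1) - 1 = s - p by ring]
    by_cases h1 : h ∈ w (s - p)
    · have h2 := hw.notMem' h1
      simp [h1, h2]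
      ring
    · by_cases h2 : h ∈ w (s - p - 1)
      · simp [h1, h2]
        ring
      · simp [h1, h2]

theorem rho_view {w : ℤ → Finset S} (hw : Disj w) (s : ℤ) (r : Bool) (f : FreeGroup S) :
    ∀ p, vert s r (rho (view w s r) f p) = rho w f (vert s r p) := by
  induction f using freeGroup_induction with
  | one => simp
  | of h => intro p; rw [rho_of hw, rho_of (hw.view s r), step_view hw]
  | inv h ih => rw [rho_of_inv hw, rho_of_inv (hw.view s r)]; exact ih
  | mul f g hf hg => intro p; simp only [map_mul, Perm.mul_apply]; rw [hf, hg]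

theorem step_sub_le (w : ℤ → Finset S) (h : S) (n : ℤ) : |step w h n - n| ≤ 1 := by
  unfold step
  split_ifs <;> simp

/-- The image of a vertex under an element of the free group depends only on a neighborhood of the
vertex, whose radius does not depend on the sequence. -/
theorem exists_radius (f : FreeGroup S) : ∃ R : ℕ, ∀ w : ℤ → Finset S, Disj w → ∀ p,
    |rho w f p - p| ≤ R ∧ ∀ w' : ℤ → Finset S, Disj w' → (∀ j, |j - p| ≤ R → w' j = w j) →
      rho w' f p = rho w f p := by
  induction f using freeGroup_induction with
  | one => exact ⟨0, by simp⟩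
  | of h =>
    refine ⟨1, fun w hw p => ⟨?_, fun w' hw' hj => ?_⟩⟩
    · rw [rho_of hw]; exact_mod_cast step_sub_le w h p
    · rw [rho_of hw, rho_of hw']
      exact step_congr (hj _ (by simp)) (hj _ (by simp))
  | inv h ih =>
    obtain ⟨R, hR⟩ := ih
    refine ⟨R, fun w hw p => ?_⟩
    rw [rho_of_inv hw]
    refine ⟨(hR w hw p).1, fun w' hw' hj => ?_⟩
    rw [rho_of_inv hw']
    exact (hR w hw p).2 w' hw' hj
  | mul f g hf hg =>
    obtain ⟨R, hR⟩ := hf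
    obtain ⟨T, hT⟩ := hg
    refine ⟨R + T, fun w hw p => ?_⟩
    have h1 := (hT w hw p).1
    have h2 := (hR w hw (rho w g p)).1
    rw [abs_le] at h1 h2
    refine ⟨?_, fun w' hw' hj => ?_⟩
    · simp only [map_mul, Perm.mul_apply, abs_le, Nat.cast_add]
      constructor <;> linarith
    · simp only [map_mul, Perm.mul_apply]
      rw [(hT w hw p).2 w' hw' (fun j hj' => hj j (by rw [abs_le] at *; push_cast; omega))]
      exact (hR w hw _).2 w' hw' (fun j hj' => hj j (by rw [abs_le] at *; push_cast; omega))

/-- Two sequences which are translates of each other near two vertices define the same action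
there. -/
theorem rho_shift_eq {w w' : ℤ → Finset S} (hw : Disj w) (hw' : Disj w') {f : FreeGroup S} {R : ℕ}
    (hR : ∀ w : ℤ → Finset S, Disj w → ∀ p,
      |rho w f p - p| ≤ R ∧ ∀ w' : ℤ → Finset S, Disj w' → (∀ j, |j - p| ≤ R → w' j = w j) →
        rho w' f p = rho w f p) {i j : ℤ} (h : ∀ t : ℤ, |t| ≤ R → w (i + t) = w' (j + t)) :
    rho w f i - i = rho w' f j - j := by
  have h1 := rho_view hw i false f 0
  have h2 := rho_view hw' j false f 0
  have h3 := (hR _ (hw'.view j false) 0).2 _ (hw.view i false) (fun t ht => by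
    simp only [sub_zero] at ht
    simpa [view] using h t ht)
  simp only [vert, Bool.false_eq_true, if_false, add_zero] at h1 h2
  rw [← h1, ← h2, h3]
  ring

theorem step_mem_Icc {w : ℤ → Finset S} {a b : ℤ} (ha : w (a - 1) = ∅) (hb : w b = ∅) (h : S)
    {p : ℤ} (hp : a ≤ p ∧ p ≤ b) : a ≤ step w h p ∧ step w h p ≤ b := by
  unfold step
  split_ifs with h1 h2
  · have : p ≠ b := by rintro rfl; simp [hb] at h1
    omega
  · have : p ≠ a := by rintro rfl; simp [ha] at h2
    omega
  · exact hp

theorem rho_mem_Icc {w : ℤ → Finset S} (hw : Disj w) {a b : ℤ} (ha : w (a - 1) = ∅) (hb : w b = ∅)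
    (f : FreeGroup S) : ∀ p, (a ≤ p ∧ p ≤ b) → a ≤ rho w f p ∧ rho w f p ≤ b := by
  induction f using freeGroup_induction with
  | one => simp
  | of h => intro p hp; rw [rho_of hw]; exact step_mem_Icc ha hb h hp
  | inv h ih => rw [rho_of_inv hw]; exact ih
  | mul f g hf hg => intro p hp; simp only [map_mul, Perm.mul_apply]; exact hf _ (hg _ hp)

theorem rho_eq_self_of_empty {w : ℤ → Finset S} (hw : Disj w) {p : ℤ} (h1 : w p = ∅)
    (h2 : w (p - 1) = ∅) (f : FreeGroup S) : rho w f p = p := by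
  have := rho_mem_Icc hw h2 h1 f p ⟨le_rfl, le_rfl⟩
  omega

end Action

end LinearGraph

namespace AlphaGroup

open LinearGraph Equiv
open scoped commutatorElement

/-! ### The recursive structure of the blocks -/

/-- The two types of blocks of a generation. -/
inductive Block
  | I | J

/-- The block `I_n` or `J_n`. -/
def blk (α : ℕ → Symb) (n : ℕ) : Block → List (Finset Gen)
  | .I => (IJ α n).1
  | .J => (IJ α n).2

/-- The number of edges of a block; its vertices are `0, 1, …, len α n B`. -/
def len (α : ℕ → Symb) (n : ℕ) (B : Block) : ℤ := (blk α n B).length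

/-- A block seen as an isolated finite segment. -/
def std (α : ℕ → Symb) (n : ℕ) (B : Block) : ℤ → Finset Gen := ofList (blk α n B)

/-- The connector following the first `J_n` in `J_{n+1}`. -/
def Symb.head : Symb → Finset Gen
  | .sigma => {.x}
  | .word _ _ => conn 1

/-- The connectors following the successive copies of `I_n` in `J_{n+1}`. -/
def Symb.tail : Symb → List (Finset Gen)
  | .sigma => [{.y}, {.y}]
  | .word t _ => t.map fun z => {z.toGen}

/-- The labels of the edges inside the blocks of generation `0`. -/
def aSet : Finset Gen := {.a0, .a1, .a2}

/-- The labels of the edges connecting two blocks. -/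
def IsConn (A : Finset Gen) : Prop :=
  A = {.x} ∨ A = {.y} ∨ A = {.b, .c} ∨ A = {.d, .b} ∨ A = {.c, .d}

theorem IsConn.disjoint {A : Finset Gen} (h : IsConn A) : Disjoint A aSet := by
  rcases h with rfl | rfl | rfl | rfl | rfl <;> decide

theorem isConn_conn (n : ℕ) : IsConn (conn n) := by
  unfold conn IsConn
  split_ifs <;> simp

theorem Symb.isConn_head (s : Symb) : IsConn s.head := by
  cases s with
  | sigma => exact Or.inl rfl
  | word t ht => exact isConn_conn 1

theorem Symb.exists_of_mem_tail {s : Symb} {A : Finset Gen} (h : A ∈ s.tail) :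
    ∃ z : Letter, A = {z.toGen} := by
  cases s with
  | sigma =>
    simp only [Symb.tail, List.mem_cons, List.not_mem_nil, or_false, or_self] at h
    exact ⟨.y, h⟩
  | word t ht =>
    simp only [Symb.tail, List.mem_map] at h
    obtain ⟨z, _, rfl⟩ := h
    exact ⟨z, rfl⟩

theorem Symb.isConn_of_mem_tail {s : Symb} {A : Finset Gen} (h : A ∈ s.tail) : IsConn A := by
  obtain ⟨z, rfl⟩ := s.exists_of_mem_tail h
  cases z
  · exact Or.inl rfl
  · exact Or.inr (Or.inl rfl)

theorem Symb.tail_ne_nil (s : Symb) : s.tail ≠ [] := by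
  cases s with
  | sigma => simp [Symb.tail]
  | word t ht => simpa [Symb.tail] using ht

variable {α : ℕ → Symb}

theorem blk_I_succ (n : ℕ) :
    blk α (n + 1) .I = blk α n .J ++ [conn n] ++ (blk α n .J).reverse := rfl

theorem blk_J_succ (n : ℕ) : blk α (n + 1) .J = blk α n .J ++ [(α n).head] ++
    (α n).tail.flatMap (fun A => blk α n .I ++ [A]) ++ (blk α n .J).reverse := by
  simp only [blk, IJ]
  cases α n with
  | sigma => simp [Symb.head, Symb.tail]
  | word t ht => simp [Symb.head, Symb.tail, List.flatMap_map]

theorem flatMap_append_induction {P : List (Finset Gen) → Prop} {u : List (Finset Gen)} (hu : P u)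
    (app : ∀ l m A, P l → P m → IsConn A → P (l ++ [A] ++ m)) {m : List (Finset Gen)} (hm : P m) :
    ∀ (t : List (Finset Gen)) (l : List (Finset Gen)) (e : Finset Gen), (∀ A ∈ t, IsConn A) →
      IsConn e → P l → P (l ++ [e] ++ t.flatMap (fun A => u ++ [A]) ++ m) := by
  intro t
  induction t with
  | nil => intro l e _ he hl; simpa using app l m e hl hm he
  | cons A t ih =>
    intro l e ht he hl
    have := ih (l ++ [e] ++ u) A (fun B hB => ht B (List.mem_cons_of_mem _ hB))
      (ht A List.mem_cons_self) (app l u e hl hu he)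
    simpa using this

/-- A property of words which is preserved by reversing and by joining words with a connector
holds for all blocks, if it holds for those of the initial generation. -/
theorem blk_induction {P : List (Finset Gen) → Prop} {n₀ : ℕ} (base : ∀ B, P (blk α n₀ B))
    (rev : ∀ l, P l → P l.reverse)
    (app : ∀ l m A, P l → P m → IsConn A → P (l ++ [A] ++ m)) :
    ∀ n, n₀ ≤ n → ∀ B, P (blk α n B) := by
  intro n hn
  induction n, hn using Nat.le_induction with
  | base => exact base
  | succ n _ ih =>
    rintro (_ | _)
    · rw [blk_I_succ]
      exact app _ _ _ (ih _) (rev _ (ih _)) (isConn_conn n)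
    · rw [blk_J_succ]
      exact flatMap_append_induction (ih _) app (rev _ (ih _)) _ _ _
        (fun A hA => Symb.isConn_of_mem_tail hA) (Symb.isConn_head _) (ih _)

theorem blk_good (n : ℕ) (B : Block) : Good (blk α n B) := by
  cases B
  · exact (IJ_good α n).1
  · exact (IJ_good α n).2

theorem disj_std (n : ℕ) (B : Block) : Disj (std α n B) := disj_ofList (blk_good n B).1

theorem len_pos (n : ℕ) (B : Block) : 0 < len α n B := by
  have := List.length_pos_iff.mpr (blk_good (α := α) n B).2.2.1
  unfold len
  omega

theorem len_zero (B : Block) : len α 0 B = 2 := by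
  cases B <;> rfl

theorem len_I_succ (n : ℕ) : len α (n + 1) .I = 2 * len α n .J + 1 := by
  simp only [len, blk_I_succ]
  simp
  ring

theorem length_flatMap_append {A : Type*} (u : List A) (t : List A) :
    (t.flatMap (fun a => u ++ [a])).length = t.length * (u.length + 1) := by
  induction t with
  | nil => simp
  | cons a t ih => simp only [List.flatMap_cons, List.length_append, ih, List.length_cons,
      List.length_nil]; ring

theorem len_J_succ (n : ℕ) : len α (n + 1) .J =
    2 * len α n .J + 1 + (α n).tail.length * (len α n .I + 1) := by
  simp only [len, blk_J_succ, List.length_append, length_flatMap_append]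
  simp
  ring

theorem len_J_lt_succ (n : ℕ) (B : Block) : 2 * len α n .J < len α (n + 1) B := by
  cases B
  · rw [len_I_succ]; omega
  · rw [len_J_succ]
    have := len_pos (α := α) n .I
    have : 0 ≤ ((α n).tail.length : ℤ) * (len α n .I + 1) := by positivity
    omega

theorem le_len (n : ℕ) (B : Block) : (n : ℤ) + 2 ≤ len α n B := by
  induction n generalizing B with
  | zero => simp [len_zero]
  | succ n ih =>
    have := len_J_lt_succ (α := α) n B
    have := ih .J
    push_cast
    omega

theorem std_neg (n : ℕ) (B : Block) {p : ℤ} (hp : p < 0) : std α n B p = ∅ := ofList_of_neg _ hp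

theorem std_ge (n : ℕ) (B : Block) {p : ℤ} (hp : len α n B ≤ p) : std α n B p = ∅ :=
  ofList_of_ge _ hp

theorem reads_std (n : ℕ) (B : Block) : Reads (std α n B) 0 (blk α n B) := reads_ofList _

theorem rho_std_mem (n : ℕ) (B : Block) (f : FreeGroup Gen) {p : ℤ}
    (hp : 0 ≤ p ∧ p ≤ len α n B) :
    0 ≤ rho (std α n B) f p ∧ rho (std α n B) f p ≤ len α n B :=
  rho_mem_Icc (disj_std n B) (std_neg n B (by omega)) (std_ge n B le_rfl) f p hp

theorem rho_std_of_notMem (n : ℕ) (B : Block) (f : FreeGroup Gen) {p : ℤ}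
    (hp : ¬ (0 ≤ p ∧ p ≤ len α n B)) : rho (std α n B) f p = p := by
  rcases lt_or_ge p 0 with h | h
  · exact rho_eq_self_of_empty (disj_std n B) (std_neg n B h) (std_neg n B (by omega)) f
  · exact rho_eq_self_of_empty (disj_std n B) (std_ge n B (by omega)) (std_ge n B (by omega)) f

theorem reads_flatMap {w : ℤ → Finset Gen} {u : List (Finset Gen)} : ∀ {t : List (Finset Gen)}
    {p : ℤ}, Reads w p (t.flatMap (fun A => u ++ [A])) → ∀ i : ℕ, i < t.length →
      Reads w (p + i * (u.length + 1)) u ∧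
        w (p + i * (u.length + 1) + u.length) = t.getD i ∅ := by
  intro t
  induction t with
  | nil => simp
  | cons A t ih =>
    intro p h i hi
    rw [List.flatMap_cons, reads_append, reads_append, reads_singleton] at h
    obtain ⟨⟨h1, h2⟩, h3⟩ := h
    cases i with
    | zero => simpa using ⟨h1, h2⟩
    | succ i =>
      have := ih h3 i (by simpa using hi)
      simp only [List.length_append, List.length_cons, List.length_nil] at this
      simp only [List.getD_cons_succ]
      have e : p + ((u.length + (0 + 1) : ℕ) : ℤ) + i * (u.length + 1) =
          p + ((i + 1 : ℕ) : ℤ) * (u.length + 1) := by push_cast; ring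
      rwa [e] at this

/-- The blocks of generation `n` from which a block of generation `n + 1` is formed: `Sub α n B B'
s r` means that a block of type `B'` is placed at the vertex `s` of the block of type `B`, in the
opposite direction if `r` is true. -/
inductive Sub (α : ℕ → Symb) (n : ℕ) : Block → Block → ℤ → Bool → Prop
  | left (B : Block) : Sub α n B .J 0 false
  | right (B : Block) : Sub α n B .J (len α (n + 1) B) true
  | mid (i : ℕ) (hi : i < (α n).tail.length) :
      Sub α n .J .I (len α n .J + 1 + i * (len α n .I + 1)) false

/-- The vertex `q` is an end of one of the blocks placed by `O`. -/
def IsEnd (α : ℕ → Symb) (n : ℕ) (O : Block → ℤ → Bool → Prop) (q : ℤ) : Prop :=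
  ∃ B s r, O B s r ∧ (q = vert s r 0 ∨ q = vert s r (len α n B))

section Decompose

variable {n : ℕ} {v : ℤ → Finset Gen}

theorem reads_J_succ (h : Reads v 0 (blk α (n + 1) .J)) :
    Reads v 0 (blk α n .J) ∧ v (len α n .J) = (α n).head ∧
    (∀ i : ℕ, i < (α n).tail.length →
      Reads v (len α n .J + 1 + i * (len α n .I + 1)) (blk α n .I) ∧
      v (len α n .J + 1 + i * (len α n .I + 1) + len α n .I) = (α n).tail.getD i ∅) ∧
    Reads v (len α (n + 1) .J - len α n .J) (blk α n .J).reverse := by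
  have hl := len_J_succ (α := α) n
  rw [blk_J_succ, reads_append, reads_append, reads_append, reads_singleton] at h
  obtain ⟨⟨⟨h1, h2⟩, h3⟩, h4⟩ := h
  refine ⟨h1, by simpa [len] using h2, fun i hi => ?_, ?_⟩
  · have := reads_flatMap h3 i hi
    simp only [List.length_append, List.length_cons, List.length_nil] at this
    simp only [len]
    convert this using 3 <;> (push_cast; ring)
  · rw [hl]
    convert h4 using 1
    simp only [List.length_append, length_flatMap_append, len]
    push_cast
    simp
    ring

theorem reads_I_succ (h : Reads v 0 (blk α (n + 1) .I)) :
    Reads v 0 (blk α n .J) ∧ v (len α n .J) = conn n ∧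
    Reads v (len α (n + 1) .I - len α n .J) (blk α n .J).reverse := by
  have hl := len_I_succ (α := α) n
  rw [blk_I_succ, reads_append, reads_append, reads_singleton] at h
  obtain ⟨⟨h1, h2⟩, h3⟩ := h
  refine ⟨h1, by simpa [len] using h2, ?_⟩
  rw [hl]
  convert h3 using 1
  simp only [len, List.length_append, List.length_cons, List.length_nil]
  push_cast
  ring

theorem Sub.reads {B B' : Block} {s : ℤ} {r : Bool} (hs : Sub α n B B' s r)
    (h : Reads v 0 (blk α (n + 1) B)) : Reads (view v s r) 0 (blk α n B') := by
  cases hs with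
  | left =>
    rw [reads_view]
    cases B
    · exact (reads_I_succ h).1
    · exact (reads_J_succ h).1
  | right =>
    rw [reads_view_reverse]
    cases B
    · exact (reads_I_succ h).2.2
    · exact (reads_J_succ h).2.2.2
  | mid i hi =>
    rw [reads_view, add_zero]
    exact ((reads_J_succ h).2.2.1 i hi).1

theorem isConn_getD_tail {s : Symb} {i : ℕ} (hi : i < s.tail.length) :
    IsConn (s.tail.getD i ∅) := by
  rw [List.getD_eq_getElem _ _ hi]
  exact Symb.isConn_of_mem_tail (List.getElem_mem hi)

/-- The last copy of `I_n` in `J_{n+1}` is followed by a connector and by the final, reversed,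
copy of `J_n`. -/
theorem tail_length_cast (n : ℕ) : ∃ i : ℕ, i < (α n).tail.length ∧
    ((α n).tail.length : ℤ) = i + 1 := by
  have := List.length_pos_iff.mpr (α n).tail_ne_nil
  exact ⟨(α n).tail.length - 1, by omega, by omega⟩

theorem Sub.right_edge {B B' : Block} {s : ℤ} {r : Bool} (hs : Sub α n B B' s r)
    (h : Reads v 0 (blk α (n + 1) B)) : IsConn (view v s r (len α n B')) ∧
      IsEnd α n (Sub α n B) (vert s r (len α n B' + 1)) := by
  cases hs with
  | left =>
    simp only [view, vert, Bool.false_eq_true, if_false, zero_add]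
    cases B
    · rw [(reads_I_succ h).2.1]
      refine ⟨isConn_conn n, .J, _, _, .right .I, Or.inr ?_⟩
      simp only [vert, len_I_succ, if_true]
      ring
    · rw [(reads_J_succ h).2.1]
      refine ⟨Symb.isConn_head _, .I, _, _, .mid 0 (List.length_pos_iff.mpr (α n).tail_ne_nil),
        Or.inl ?_⟩
      simp [vert]
  | right =>
    simp only [view, vert, if_true]
    cases B
    · rw [show len α (n + 1) .I - len α n .J - 1 = len α n .J by rw [len_I_succ]; ring,
        (reads_I_succ h).2.1]
      refine ⟨isConn_conn n, .J, _, _, .left .I, Or.inr ?_⟩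
      simp only [vert, len_I_succ, Bool.false_eq_true, if_false]
      ring
    · obtain ⟨i, hi, hi'⟩ := tail_length_cast (α := α) n
      rw [show len α (n + 1) .J - len α n .J - 1 =
        len α n .J + 1 + i * (len α n .I + 1) + len α n .I by rw [len_J_succ, hi']; ring,
        ((reads_J_succ h).2.2.1 i hi).2]
      refine ⟨isConn_getD_tail hi, .I, _, _, .mid i hi, Or.inr ?_⟩
      simp only [vert, len_J_succ, hi', Bool.false_eq_true, if_false]
      ring
  | mid i hi =>
    simp only [view, vert, Bool.false_eq_true, if_false]
    rw [((reads_J_succ h).2.2.1 i hi).2]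
    refine ⟨isConn_getD_tail hi, ?_⟩
    obtain ⟨j, hj, hj'⟩ := tail_length_cast (α := α) n
    rcases Nat.lt_or_ge (i + 1) (α n).tail.length with h1 | h1
    · refine ⟨.I, _, _, .mid (i + 1) h1, Or.inl ?_⟩
      simp only [vert, Bool.false_eq_true, if_false]
      push_cast
      ring
    · obtain rfl : i = j := by omega
      refine ⟨.J, _, _, .right .J, Or.inr ?_⟩
      simp only [vert, len_J_succ, hj', if_true]
      ring

theorem Sub.left_edge {B B' : Block} {s : ℤ} {r : Bool} (hs : Sub α n B B' s r)
    (h : Reads v 0 (blk α (n + 1) B)) :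
    (vert s r (-1) = -1 ∧ view v s r (-1) = v (-1)) ∨
    (vert s r (-1) = len α (n + 1) B + 1 ∧ view v s r (-1) = v (len α (n + 1) B)) ∨
    (IsConn (view v s r (-1)) ∧ IsEnd α n (Sub α n B) (vert s r (-1))) := by
  cases hs with
  | left => left; simp [vert, view]
  | right => right; left; simp [vert, view]
  | mid i hi =>
    right; right
    simp only [view, vert, Bool.false_eq_true, if_false]
    cases i with
    | zero =>
      rw [show len α n .J + 1 + ((0 : ℕ) : ℤ) * (len α n .I + 1) + -1 = len α n .J by simp,
        (reads_J_succ h).2.1]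
      exact ⟨Symb.isConn_head _, .J, _, _, .left .J, Or.inr (by simp [vert])⟩
    | succ i =>
      rw [show len α n .J + 1 + ((i + 1 : ℕ) : ℤ) * (len α n .I + 1) + -1 =
        len α n .J + 1 + i * (len α n .I + 1) + len α n .I by push_cast; ring,
        ((reads_J_succ h).2.2.1 i (by omega)).2]
      exact ⟨isConn_getD_tail (by omega), .I, _, _, .mid i (by omega), Or.inr (by simp [vert])⟩

/-- Every vertex of a block belongs to one of the blocks of the preceding generation. -/
theorem exists_sub (B : Block) {p : ℤ} (hp : 0 ≤ p ∧ p ≤ len α (n + 1) B) :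
    ∃ B' s r p', Sub α n B B' s r ∧ (0 ≤ p' ∧ p' ≤ len α n B') ∧ p = vert s r p' := by
  rcases le_or_gt p (len α n .J) with h1 | h1
  · exact ⟨.J, _, _, p, .left B, ⟨hp.1, h1⟩, by simp [vert]⟩
  rcases le_or_gt (len α (n + 1) B - len α n .J) p with h2 | h2
  · exact ⟨.J, _, _, len α (n + 1) B - p, .right B, ⟨by omega, by omega⟩, by simp [vert]⟩
  cases B with
  | I => rw [len_I_succ] at h2; omega
  | J =>
    rw [len_J_succ] at h2
    have hl := len_pos (α := α) n .I
    set q := p - len α n .J - 1 with hq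
    set l := len α n .I with hl'
    have e1 := Int.emod_add_mul_ediv q (l + 1)
    have e2 := Int.emod_nonneg q (show l + 1 ≠ 0 by omega)
    have e3 := Int.emod_lt_of_pos q (show 0 < l + 1 by omega)
    have e4 : 0 ≤ q / (l + 1) := Int.ediv_nonneg (by omega) (by omega)
    have e5 : q / (l + 1) < (α n).tail.length := by
      rw [Int.ediv_lt_iff_lt_mul (by omega)]
      omega
    obtain ⟨i, hi⟩ := Int.eq_ofNat_of_zero_le e4
    refine ⟨.I, _, _, q % (l + 1), .mid i (by omega), ⟨e2, by omega⟩, ?_⟩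
    simp only [vert, Bool.false_eq_true, if_false]
    rw [hi] at e1
    rw [← hl']
    linarith

end Decompose

/-! ### Parsed sequences and local elements -/

/-- A family of placements of blocks of generation `n` in a sequence: `O B s r` means that a block
of type `B` is placed at `s`, in the opposite direction if `r` is true. The two outer edges of a
placed block contain no `a_i`, and if there is a neighbor across such an edge, then it is an end of
another placed block. -/
structure Parse (α : ℕ → Symb) (n : ℕ) (w : ℤ → Finset Gen) (O : Block → ℤ → Bool → Prop) :
    Prop where
  disj : Disj w
  reads : ∀ {B s r}, O B s r → Reads (view w s r) 0 (blk α n B)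
  left : ∀ {B s r}, O B s r → Disjoint (view w s r (-1)) aSet ∧
    ((view w s r (-1)).Nonempty → IsEnd α n O (vert s r (-1)))
  right : ∀ {B s r}, O B s r → Disjoint (view w s r (len α n B)) aSet ∧
    ((view w s r (len α n B)).Nonempty → IsEnd α n O (vert s r (len α n B + 1)))

/-- The placements of the blocks of generation `n` which form the placed blocks of
generation `n + 1`. -/
def refine (α : ℕ → Symb) (n : ℕ) (O : Block → ℤ → Bool → Prop) (B' : Block) (s' : ℤ) (r' : Bool) :
    Prop :=
  ∃ B s r s₀ r₀, O B s r ∧ Sub α n B B' s₀ r₀ ∧ s' = vert s r s₀ ∧ r' = xor r r₀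

theorem isEnd_refine_of_sub {n : ℕ} {O : Block → ℤ → Bool → Prop} {B s r} (hO : O B s r) {q : ℤ}
    (hq : IsEnd α n (Sub α n B) q) : IsEnd α n (refine α n O) (vert s r q) := by
  obtain ⟨B', s₀, r₀, hs, hq⟩ := hq
  refine ⟨B', _, _, ⟨B, s, r, s₀, r₀, hO, hs, rfl, rfl⟩, ?_⟩
  rw [← vert_vert, ← vert_vert]
  exact hq.imp (congrArg _) (congrArg _)

theorem isEnd_refine {n : ℕ} {O : Block → ℤ → Bool → Prop} {q : ℤ}
    (hq : IsEnd α (n + 1) O q) : IsEnd α n (refine α n O) q := by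
  obtain ⟨B, s, r, hO, rfl | rfl⟩ := hq
  · exact isEnd_refine_of_sub hO ⟨.J, _, _, .left B, Or.inl (by simp [vert])⟩
  · exact isEnd_refine_of_sub hO ⟨.J, _, _, .right B, Or.inl (by simp [vert])⟩

theorem Parse.refine {n : ℕ} {w : ℤ → Finset Gen} {O : Block → ℤ → Bool → Prop}
    (h : Parse α (n + 1) w O) : Parse α n w (refine α n O) where
  disj := h.disj
  reads := by
    rintro B' _ _ ⟨B, s, r, s₀, r₀, hO, hs, rfl, rfl⟩
    rw [← view_view]
    exact hs.reads (h.reads hO)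
  left := by
    rintro B' _ _ ⟨B, s, r, s₀, r₀, hO, hs, rfl, rfl⟩
    rw [← view_view, ← vert_vert]
    rcases hs.left_edge (h.reads hO) with ⟨h1, h2⟩ | ⟨h1, h2⟩ | ⟨h1, h2⟩
    · rw [h1, h2]
      exact (h.left hO).imp id fun h3 h4 => isEnd_refine (h3 h4)
    · rw [h1, h2]
      exact (h.right hO).imp id fun h3 h4 => isEnd_refine (h3 h4)
    · exact ⟨h1.disjoint, fun _ => isEnd_refine_of_sub hO h2⟩
  right := by
    rintro B' _ _ ⟨B, s, r, s₀, r₀, hO, hs, rfl, rfl⟩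
    rw [← view_view, ← vert_vert]
    obtain ⟨h1, h2⟩ := hs.right_edge (h.reads hO)
    exact ⟨h1.disjoint, fun _ => isEnd_refine_of_sub hO h2⟩

theorem view_zero_false (w : ℤ → Finset Gen) : view w 0 false = w := by
  funext p; simp [view]

/-- A block alone is parsed. -/
theorem parse_std (n : ℕ) (B : Block) :
    Parse α n (std α n B) (fun B' s r => B' = B ∧ s = 0 ∧ r = false) where
  disj := disj_std n B
  reads := by
    rintro _ _ _ ⟨rfl, rfl, rfl⟩
    rw [view_zero_false]
    exact reads_std n _
  left := by
    rintro _ _ _ ⟨rfl, rfl, rfl⟩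
    simp [view_zero_false, std_neg]
  right := by
    rintro _ _ _ ⟨rfl, rfl, rfl⟩
    simp [view_zero_false, std_ge]

/-- An element of the free group is local in generation `n` if it maps every placed block of this
generation to itself, acting there as on the block alone. -/
def Local (α : ℕ → Symb) (n : ℕ) (f : FreeGroup Gen) : Prop :=
  ∀ w O, Parse α n w O → ∀ B s r, O B s r → ∀ p, (0 ≤ p ∧ p ≤ len α n B) →
    rho (view w s r) f p = rho (std α n B) f p

theorem Local.one (n : ℕ) : Local α n 1 := by
  intro w O hO B s r h p hp
  simp

theorem Local.mul {n : ℕ} {f g : FreeGroup Gen} (hf : Local α n f) (hg : Local α n g) :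
    Local α n (f * g) := by
  intro w O hO B s r h p hp
  simp only [map_mul, Perm.mul_apply]
  rw [hg w O hO B s r h p hp, hf w O hO B s r h _ (rho_std_mem n B g hp)]

theorem Local.inv {n : ℕ} {f : FreeGroup Gen} (hf : Local α n f) : Local α n f⁻¹ := by
  intro w O hO B s r h p hp
  have h1 := rho_std_mem n B f⁻¹ hp
  have h2 := hf w O hO B s r h _ h1
  rw [map_inv, Perm.inv_eq_iff_eq]
  rw [map_inv (rho (std α n B)), Perm.coe_inv, apply_symm_apply] at h2
  rw [map_inv, Perm.coe_inv, h2]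

/-- The elements local in generation `n` form a subgroup. -/
def localSubgroup (α : ℕ → Symb) (n : ℕ) : Subgroup (FreeGroup Gen) where
  carrier := {f | Local α n f}
  one_mem' := Local.one n
  mul_mem' := Local.mul
  inv_mem' := Local.inv

/-- The inner edges of a placed block are those of the block. -/
theorem Parse.view_eq {n : ℕ} {w : ℤ → Finset Gen} {O : Block → ℤ → Bool → Prop}
    (hO : Parse α n w O) {B s r} (h : O B s r) {p : ℤ} (h0 : 0 ≤ p) (h1 : p < len α n B) :
    view w s r p = std α n B p :=
  (hO.reads h).eq_ofList h0 h1

/-- A generator acts on a placed block as on the block alone, unless it moves an end of the block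
across an outer edge. -/
theorem Parse.step_view {n : ℕ} {w : ℤ → Finset Gen} {O : Block → ℤ → Bool → Prop}
    (hO : Parse α n w O) {B s r} (h : O B s r) (g : Gen) {p : ℤ}
    (hp : 0 ≤ p ∧ p ≤ len α n B) :
    step (view w s r) g p = step (std α n B) g p ∨
    (p = 0 ∧ g ∈ view w s r (-1) ∧ step (std α n B) g 0 = 0) ∨
    (p = len α n B ∧ g ∈ view w s r (len α n B) ∧
      step (std α n B) g (len α n B) = len α n B) := by
  have hd := hO.disj.view s r
  have hl := len_pos (α := α) n B
  have hneg : g ∉ std α n B (-1) := by simp [std_neg]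
  have hge : g ∉ std α n B (len α n B) := by simp [std_ge]
  rcases hp.1.eq_or_lt with rfl | h0
  · have e := hO.view_eq h le_rfl hl
    by_cases hg : g ∈ view w s r (-1)
    · have := hd.notMem hg
      rw [neg_add_cancel, e] at this
      exact Or.inr (Or.inl ⟨rfl, hg, step_of_notMem this (by simpa using hneg)⟩)
    · left
      simp [step, e, hg, hneg]
  rcases hp.2.eq_or_lt with rfl | h1
  · have e := hO.view_eq h (p := len α n B - 1) (by omega) (by omega)
    by_cases hg : g ∈ view w s r (len α n B)
    · have := hd.notMem' hg
      rw [e] at this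
      exact Or.inr (Or.inr ⟨rfl, hg, step_of_notMem hge this⟩)
    · left
      simp [step, e, hg, hge]
  · left
    exact step_congr (hO.view_eq h h0.le h1) (hO.view_eq h (by omega) (by omega))

/-- The generators `a_i` are local in every generation. -/
theorem local_of_mem_aSet (n : ℕ) {g : Gen} (hg : g ∈ aSet) : Local α n (FreeGroup.of g) := by
  intro w O hO B s r h p hp
  rw [rho_of (hO.disj.view s r), rho_of (disj_std n B)]
  rcases hO.step_view h g hp with h1 | ⟨_, h1, _⟩ | ⟨_, h1, _⟩
  · exact h1
  · exact absurd hg (Finset.disjoint_left.mp (hO.left h).1 h1)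
  · exact absurd hg (Finset.disjoint_left.mp (hO.right h).1 h1)

/-- A local element which fixes the ends of the isolated blocks fixes the ends of all placed
blocks. -/
theorem Local.rho_isEnd {n : ℕ} {f : FreeGroup Gen} (hf : Local α n f)
    (hend : ∀ B, rho (std α n B) f 0 = 0 ∧ rho (std α n B) f (len α n B) = len α n B)
    {w : ℤ → Finset Gen} {O : Block → ℤ → Bool → Prop} (hO : Parse α n w O) {q : ℤ}
    (hq : IsEnd α n O q) : rho w f q = q := by
  obtain ⟨B, s, r, h, rfl | rfl⟩ := hq
  · rw [← rho_view hO.disj, hf w O hO B s r h 0 ⟨le_rfl, (len_pos n B).le⟩, (hend B).1]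
  · rw [← rho_view hO.disj, hf w O hO B s r h _ ⟨(len_pos n B).le, le_rfl⟩, (hend B).2]

/-- A local element which fixes the ends of the blocks stays local when it is conjugated by
a generator: the vertices which the generator moves out of a block are fixed by the element. -/
theorem Local.conj_of {n : ℕ} {f : FreeGroup Gen} (hf : Local α n f)
    (hend : ∀ B, rho (std α n B) f 0 = 0 ∧ rho (std α n B) f (len α n B) = len α n B) (g : Gen) :
    Local α n (FreeGroup.of g * f * (FreeGroup.of g)⁻¹) := by
  intro w O hO B s r h p hp
  have hd := hO.disj.view s r
  have hs := disj_std (α := α) n B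
  have hl := len_pos (α := α) n B
  simp only [map_mul, Perm.mul_apply, rho_of_inv hd, rho_of_inv hs, rho_of hd, rho_of hs]
  -- an end moved across an outer edge comes back, and the element fixes its image
  have key : ∀ q, IsEnd α n O (vert s r q) → rho (view w s r) f q = q := fun q hq =>
    vert_injective s r (by rw [rho_view hO.disj, hf.rho_isEnd hend hO hq])
  rcases hO.step_view h g hp with h1 | ⟨rfl, h1, h2⟩ | ⟨rfl, h1, h2⟩
  · rw [h1]
    have hq : 0 ≤ step (std α n B) g p ∧ step (std α n B) g p ≤ len α n B :=
      step_mem_Icc (std_neg n B (by omega)) (std_ge n B le_rfl) g hp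
    rw [hf w O hO B s r h _ hq]
    have hq' := rho_std_mem n B f hq
    rcases hO.step_view h g hq' with h3 | ⟨h3, h4, h5⟩ | ⟨h3, h4, h5⟩
    · exact h3
    · have e : step (std α n B) g p = 0 :=
        (rho (std α n B) f).injective (by rw [h3, (hend B).1])
      have e' : step (view w s r) g 0 = -1 := by
        rw [step_of_mem_pred hd (by simpa using h4)]; simp
      have e2 := hd.step_involutive g p
      rw [h1, e, e'] at e2
      omega
    · have e : step (std α n B) g p = len α n B :=
        (rho (std α n B) f).injective (by rw [h3, (hend B).2])
      have e' : step (view w s r) g (len α n B) = len α n B + 1 := step_of_mem h4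
      have e2 := hd.step_involutive g p
      rw [h1, e, e'] at e2
      omega
  · have e' : step (view w s r) g 0 = -1 := by
      rw [step_of_mem_pred hd (by simpa using h1)]; simp
    rw [h2, (hend B).1, h2, e', key _ ((hO.left h).2 ⟨g, h1⟩), ← e', hd.step_involutive]
  · have e' : step (view w s r) g (len α n B) = len α n B + 1 := step_of_mem h1
    rw [h2, (hend B).2, h2, e', key _ ((hO.right h).2 ⟨g, h1⟩), ← e', hd.step_involutive]

/-- The action of a local element on the blocks of the next generation. -/
theorem Local.rho_vert {n : ℕ} {f : FreeGroup Gen} (hf : Local α n f) {w : ℤ → Finset Gen}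
    {O : Block → ℤ → Bool → Prop} (hO : Parse α (n + 1) w O) {B s r} (h : O B s r) {B' s₀ r₀}
    (hs : Sub α n B B' s₀ r₀) {p : ℤ} (hp : 0 ≤ p ∧ p ≤ len α n B') :
    rho (view w s r) f (vert s₀ r₀ p) = vert s₀ r₀ (rho (std α n B') f p) := by
  rw [← rho_view (hO.disj.view s r), view_view,
    hf w _ hO.refine B' _ _ ⟨B, s, r, s₀, r₀, h, hs, rfl, rfl⟩ p hp]

theorem Local.rho_std_vert {n : ℕ} {f : FreeGroup Gen} (hf : Local α n f) {B B' s₀ r₀}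
    (hs : Sub α n B B' s₀ r₀) {p : ℤ} (hp : 0 ≤ p ∧ p ≤ len α n B') :
    rho (std α (n + 1) B) f (vert s₀ r₀ p) = vert s₀ r₀ (rho (std α n B') f p) := by
  have := hf.rho_vert (parse_std (n + 1) B) ⟨rfl, rfl, rfl⟩ hs hp
  rwa [view_zero_false] at this

theorem Local.succ {n : ℕ} {f : FreeGroup Gen} (hf : Local α n f) : Local α (n + 1) f := by
  intro w O hO B s r h p hp
  obtain ⟨B', s₀, r₀, p', hs, hp', rfl⟩ := exists_sub (α := α) B hp
  rw [hf.rho_vert hO h hs hp', hf.rho_std_vert hs hp']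

theorem Local.mono {n m : ℕ} (hnm : n ≤ m) {f : FreeGroup Gen} (hf : Local α n f) :
    Local α m f := by
  induction m, hnm using Nat.le_induction with
  | base => exact hf
  | succ m _ ih => exact ih.succ

/-! ### Products of two transpositions in a subgroup -/

section Swaps

variable {A : Type*} [DecidableEq A] {R : Subgroup (Perm A)} {T : Set A}

/-- The products of any two transpositions of elements of `T` belong to `R`, i.e. `R` contains
the finitary alternating group of `T`. -/
def SwapFull (R : Subgroup (Perm A)) (T : Set A) : Prop :=
  ∀ a ∈ T, ∀ b ∈ T, ∀ c ∈ T, ∀ d ∈ T, a ≠ b → c ≠ d → swap a b * swap c d ∈ R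

theorem SwapFull.mono {T' : Set A} (h : SwapFull R T) (hT : T' ⊆ T) : SwapFull R T' :=
  fun a ha b hb c hc d hd => h a (hT ha) b (hT hb) c (hT hc) d (hT hd)

theorem swapFull_of_forall (p q : A)
    (h : ∀ a ∈ T, ∀ b ∈ T, a ≠ b → swap p q * swap a b ∈ R) : SwapFull R T := by
  intro a ha b hb c hc d hd hab hcd
  have := R.mul_mem (R.inv_mem (h a ha b hb hab)) (h c hc d hd hcd)
  simpa [mul_assoc] using this

theorem swapFull_pair (p q : A) : SwapFull R {p, q} := by
  apply swapFull_of_forall p q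
  rintro a (rfl | rfl) b (rfl | rfl) hab
  · exact absurd rfl hab
  · simp [R.one_mem]
  · rw [swap_comm a]; simp [R.one_mem]
  · exact absurd rfl hab

/-- If `s * t` and `s * u` belong to the subgroup, where `t` and `u` are transpositions with
a common element, then so does `s * (t * u * t)`. -/
theorem mul_conj_swap_mem {s : Perm A} {q b c : A} (hs : s * s = 1) (hqc : q ≠ c) (hbc : b ≠ c)
    (h1 : s * swap q b ∈ R) (h2 : s * swap q c ∈ R) : s * swap b c ∈ R := by
  have e : swap b c = swap q b * swap q c * swap q b := by
    rw [mul_swap_eq_swap_mul (swap q b), swap_apply_left, swap_apply_of_ne_of_ne hqc.symm hbc.symm,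
      mul_assoc, swap_mul_self, mul_one]
  have hs' : s⁻¹ = s := inv_eq_of_mul_eq_one_left hs
  have := R.mul_mem (R.mul_mem h1 (R.inv_mem h2)) h1
  simp only [mul_inv_rev, swap_inv, hs', mul_assoc] at this
  rw [← mul_assoc s s, hs, one_mul] at this
  rwa [e, mul_assoc (swap q b)]

theorem SwapFull.insert (h : SwapFull R T) {p q c : A} (hp : p ∈ T) (hq : q ∈ T) (hpq : p ≠ q)
    (hc : swap p q * swap q c ∈ R) : SwapFull R (insert c T) := by
  by_cases hcT : c ∈ T
  · rwa [Set.insert_eq_of_mem hcT]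
  have hne : ∀ {a}, a ∈ T → a ≠ c := fun ha e => hcT (e ▸ ha)
  have key : ∀ b ∈ T, swap p q * swap b c ∈ R := by
    intro b hb
    by_cases hbq : q = b
    · rwa [← hbq]
    · exact mul_conj_swap_mem (swap_mul_self _ _) (hne hq) (hne hb)
        (h p hp q hq q hq b hb hpq hbq) hc
  apply swapFull_of_forall p q
  rintro a (rfl | ha) b (rfl | hb) hab
  · exact absurd rfl hab
  · rw [swap_comm a]; exact key b hb
  · exact key a ha
  · exact h p hp q hq a ha b hb hpq hab

theorem swapFull_of_fan {b c : A} (h : ∀ e ∈ T, e ≠ b → e ≠ c → swap b c * swap c e ∈ R) :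
    SwapFull R T := by
  have key : ∀ e ∈ T, e ≠ c → swap b c * swap c e ∈ R := by
    intro e he hec
    by_cases heb : e = b
    · rw [heb, swap_comm c b]; simp [R.one_mem]
    · exact h e he heb hec
  apply swapFull_of_forall b c
  intro e he f hf hef
  by_cases hec : e = c
  · rw [hec]; exact key f hf (fun hfc => hef (hec.trans hfc.symm))
  by_cases hfc : f = c
  · rw [hfc, swap_comm e]; exact key e he hec
  · exact mul_conj_swap_mem (swap_mul_self _ _) (Ne.symm hfc) hef (key e he hec) (key f hf hfc)

theorem conj_swap_mul_swap (f : Perm A) (a b c d : A) :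
    f * (swap a b * swap c d) * f⁻¹ = swap (f a) (f b) * swap (f c) (f d) := by
  have h : ∀ x y, f * swap x y = swap (f x) (f y) * f := mul_swap_eq_swap_mul f
  rw [← mul_assoc, h, mul_assoc (swap _ _), h, ← mul_assoc, mul_inv_cancel_right]

end Swaps

/-! ### The local alternating groups -/

/-- The permutations of the vertices of `J_n` which are induced by local elements belonging to `M`
and acting trivially on `I_n`. -/
noncomputable def real (α : ℕ → Symb) (n : ℕ) (M : Subgroup (FreeGroup Gen)) :
    Subgroup (Perm ℤ) :=
  (M ⊓ localSubgroup α n ⊓ (rho (std α n .I)).ker).map (rho (std α n .J))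

theorem mem_real {n : ℕ} {M : Subgroup (FreeGroup Gen)} {σ : Perm ℤ} : σ ∈ real α n M ↔
    ∃ f ∈ M, Local α n f ∧ rho (std α n .I) f = 1 ∧ rho (std α n .J) f = σ := by
  simp only [real, Subgroup.mem_map, Subgroup.mem_inf, MonoidHom.mem_ker, and_assoc]
  rfl

theorem real_conj {n : ℕ} {σ : Perm ℤ} (hσ : σ ∈ real α n ⊤) (h0 : σ 0 = 0)
    (hL : σ (len α n .J) = len α n .J) (g : Gen) :
    rho (std α n .J) (FreeGroup.of g) * σ * (rho (std α n .J) (FreeGroup.of g))⁻¹ ∈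
      real α n ⊤ := by
  obtain ⟨f, _, hf, hI, rfl⟩ := mem_real.mp hσ
  refine mem_real.mpr ⟨_, Subgroup.mem_top _, hf.conj_of ?_ g, ?_, ?_⟩
  · rintro (_ | _)
    · simp [hI]
    · exact ⟨h0, hL⟩
  · simp [hI]
  · simp

theorem real_conj_swap {n : ℕ} {p q b : ℤ} (hp : 0 < p ∧ p < len α n .J)
    (hq : 0 < q ∧ q < len α n .J) (hb : 0 < b ∧ b < len α n .J)
    (h : swap p q * swap q b ∈ real α n ⊤) (g : Gen) :
    swap (step (std α n .J) g p) (step (std α n .J) g q) *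
      swap (step (std α n .J) g q) (step (std α n .J) g b) ∈ real α n ⊤ := by
  have := real_conj h
    (by rw [Perm.mul_apply, swap_apply_of_ne_of_ne (a := q) (by omega) (by omega),
          swap_apply_of_ne_of_ne (by omega) (by omega)])
    (by rw [Perm.mul_apply, swap_apply_of_ne_of_ne (a := q) (by omega) (by omega),
          swap_apply_of_ne_of_ne (by omega) (by omega)]) g
  rw [conj_swap_mul_swap] at this
  simpa only [rho_of (disj_std n .J)] using this

theorem std_nonempty (n : ℕ) (B : Block) {p : ℤ} (h0 : 0 ≤ p) (h1 : p < len α n B) :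
    (std α n B p).Nonempty := by
  lift p to ℕ using h0
  have hp : p < (blk α n B).length := by unfold len at h1; omega
  rw [std, ofList_natCast, List.getD_eq_getElem _ _ hp]
  exact (blk_good n B).2.1 _ (List.getElem_mem hp)

/-- From generation `1` on all blocks begin with `{a0}{a2}` and end with `{a2}{a0}`. -/
theorem blk_ends {n : ℕ} (hn : 1 ≤ n) (B : Block) :
    [{.a0}, {.a2}] <+: blk α n B ∧ [{.a2}, {.a0}] <:+ blk α n B := by
  refine blk_induction (P := fun l => [{.a0}, {.a2}] <+: l ∧ [{.a2}, {.a0}] <:+ l) ?_ ?_ ?_ n hn B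
  · rintro (_ | _)
    · rw [blk_I_succ, List.append_assoc]
      exact ⟨List.prefix_append _ _, List.suffix_append_of_suffix (List.suffix_append _ _)⟩
    · rw [blk_J_succ, List.append_assoc, List.append_assoc]
      exact ⟨List.prefix_append _ _, List.suffix_append_of_suffix
        (List.suffix_append_of_suffix (List.suffix_append _ _))⟩
  · intro l ⟨h1, h2⟩
    exact ⟨by simpa using List.reverse_prefix.mpr h2, by simpa using List.reverse_suffix.mpr h1⟩
  · intro l m A h1 h2 _
    rw [List.append_assoc]
    exact ⟨h1.1.trans (List.prefix_append _ _),
      List.suffix_append_of_suffix (List.suffix_append_of_suffix h2.2)⟩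

theorem std_first {n : ℕ} {B : Block} {A A' : Finset Gen} (h : [A, A'] <+: blk α n B) :
    std α n B 0 = A ∧ std α n B 1 = A' := by
  obtain ⟨t, ht⟩ := h
  have := reads_std (α := α) n B
  rw [← ht, reads_append] at this
  simpa [Reads] using this.1

theorem std_last {n : ℕ} {B : Block} {A A' : Finset Gen} (h : [A, A'] <:+ blk α n B) :
    std α n B (len α n B - 2) = A ∧ std α n B (len α n B - 1) = A' := by
  obtain ⟨t, ht⟩ := h
  have h1 := reads_std (α := α) n B
  have h2 : len α n B = t.length + 2 := by rw [len, ← ht]; simp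
  rw [← ht, reads_append] at h1
  have := h1.2
  simp only [Reads, zero_add, and_true] at this
  rw [h2]
  refine ⟨by simpa using this.1, ?_⟩
  rw [← this.2]; congr 1; ring

theorem std_J_first (n : ℕ) : std α n .J 0 = {.a0} ∧ std α n .J 1 = {.a2} := by
  cases n with
  | zero => exact ⟨rfl, rfl⟩
  | succ n => exact std_first (blk_ends (by omega) _).1

theorem toGen_notMem_aSet (z : Letter) : z.toGen ∉ aSet := by
  cases z <;> decide

theorem toGen_notMem_conn (z : Letter) (n : ℕ) : z.toGen ∉ conn n := by
  unfold conn
  split_ifs <;> cases z <;> decide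

theorem Symb.last_tail (s : Symb) : ∃ z : Letter,
    s.tail.getD (s.tail.length - 1) ∅ = {z.toGen} ∧ z.toGen ∉ s.head := by
  have hl := List.length_pos_iff.mpr s.tail_ne_nil
  obtain ⟨z, hz⟩ := s.exists_of_mem_tail (List.getElem_mem (show s.tail.length - 1 < _ by omega))
  rw [List.getD_eq_getElem _ _ (by omega)]
  refine ⟨z, hz, ?_⟩
  cases s with
  | sigma =>
    cases z with
    | x => exact absurd hz (show ({.y} : Finset Gen) ≠ {.x} by decide)
    | y => decide
  | word t ht => exact toGen_notMem_conn z 1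

theorem step_vert_of_inner {n : ℕ} {B B' : Block} {s : ℤ} {r : Bool} (hs : Sub α n B B' s r)
    (g : Gen) {p : ℤ} (hp : 0 < p ∧ p < len α n B') :
    step (std α (n + 1) B) g (vert s r p) = vert s r (step (std α n B') g p) := by
  have h := hs.reads (reads_std (α := α) (n + 1) B)
  rw [← step_view (disj_std _ _)]
  congr 1
  exact step_congr (h.eq_ofList hp.1.le hp.2)
    (h.eq_ofList (by omega) (by have := hp.2; unfold len at this; omega))

/-- A vertex moved by a local element acting trivially on `I_n` lies in a copy of `J_n`. -/
theorem exists_sub_of_moved {n : ℕ} {f : FreeGroup Gen} (hf : Local α n f)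
    (hI : rho (std α n .I) f = 1) {B : Block} {p : ℤ} (hp : rho (std α (n + 1) B) f p ≠ p) :
    ∃ s r p', Sub α n B .J s r ∧ (0 ≤ p' ∧ p' ≤ len α n .J) ∧ p = vert s r p' ∧
      rho (std α n .J) f p' ≠ p' := by
  have hp0 : 0 ≤ p ∧ p ≤ len α (n + 1) B := by
    by_contra h
    exact hp (rho_std_of_notMem _ _ _ h)
  obtain ⟨B', s, r, p', hs, hp', rfl⟩ := exists_sub (α := α) B hp0
  rw [hf.rho_std_vert hs hp'] at hp
  cases B' with
  | I => simp [hI] at hp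
  | J => exact ⟨s, r, p', hs, hp', rfl, fun h => hp (by rw [h])⟩

/-- The edges of the final part of `J_{n+1}`, around the last connector. -/
theorem std_J_succ_end (n : ℕ) :
    std α (n + 1) .J (len α (n + 1) .J - len α n .J - 1) =
      (α n).tail.getD ((α n).tail.length - 1) ∅ ∧
    (∀ p, 0 ≤ p → p < len α n .J →
      std α (n + 1) .J (len α (n + 1) .J - p - 1) = std α n .J p) ∧
    (∀ p, 0 ≤ p → p < len α n .I →
      std α (n + 1) .J (len α (n + 1) .J - len α n .J - 1 - len α n .I + p) = std α n .I p) := by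
  have h := reads_std (α := α) (n + 1) .J
  obtain ⟨i, hi, hi'⟩ := tail_length_cast (α := α) n
  refine ⟨?_, fun p h0 h1 => ?_, fun p h0 h1 => ?_⟩
  · have := ((reads_J_succ h).2.2.1 i hi).2
    rw [show (α n).tail.length - 1 = i by omega, ← this, len_J_succ, hi']
    congr 1; ring
  · have := ((Sub.right .J).reads h).eq_ofList h0 h1
    simp only [view, if_true] at this
    exact this
  · have := ((Sub.mid i hi).reads h).eq_ofList h0 h1
    simp only [view, Bool.false_eq_true, if_false] at this
    refine Eq.trans ?_ this
    rw [len_J_succ, hi']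
    congr 1; ring

theorem len_J_succ_ge (n : ℕ) :
    2 * len α n .J + 1 + (len α n .I + 1) ≤ len α (n + 1) .J := by
  obtain ⟨i, hi, hi'⟩ := tail_length_cast (α := α) n
  have := len_pos (α := α) n .I
  rw [len_J_succ, hi']
  have : 0 ≤ (i : ℤ) * (len α n .I + 1) := by positivity
  linarith

/-- Let `z` be the letter connecting the last `I_n` with the last `J_n` in `J_{n+1}`. If a local
element acts only on the copies of `J_n`, and the only vertex moved by it that is moved by `z` is
the last one, then its commutator with `z` is a cycle of length three around the last connector
of `J_{n+1}`, since everywhere else the two elements commute. -/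
theorem start_mem_real {n : ℕ} {z : Letter}
    (hz : (α n).tail.getD ((α n).tail.length - 1) ∅ = {z.toGen}) (hz' : z.toGen ∉ (α n).head)
    {f : FreeGroup Gen} (hf : Local α n f) (hI : rho (std α n .I) f = 1)
    (hσ : ∀ p, rho (std α n .J) f p ≠ p → p = len α n .J ∨
      (0 < p ∧ p < len α n .J ∧ z.toGen ∉ std α n .J p ∧ z.toGen ∉ std α n .J (p - 1)))
    (hk : rho (std α n .J) f (len α n .J) = len α n .J - 1)
    (hlast : z.toGen ∉ std α n .J (len α n .J - 1)) :
    swap (len α (n + 1) .J - len α n .J) (len α (n + 1) .J - len α n .J - 1) *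
      swap (len α (n + 1) .J - len α n .J + 1) (len α (n + 1) .J - len α n .J - 1) ∈
      real α (n + 1) ⊤ := by
  set k := len α n .J with hkdef
  set K := len α (n + 1) .J with hK
  set v := K - k with hv
  have hkpos : 0 < k := len_pos n .J
  have hlpos := len_pos (α := α) n .I
  have hKge : 2 * k + 1 + (len α n .I + 1) ≤ K := len_J_succ_ge n
  have hdJ := disj_std (α := α) (n + 1) .J
  have hdI := disj_std (α := α) (n + 1) .I
  have h0 : rho (std α n .J) f 0 = 0 := by
    by_contra h
    rcases hσ 0 h with h | h <;> omega
  have hend : ∀ B, rho (std α (n + 1) B) f 0 = 0 ∧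
      rho (std α (n + 1) B) f (len α (n + 1) B) = len α (n + 1) B := by
    intro B
    have h1 := hf.rho_std_vert (Sub.left B) (p := 0) ⟨le_rfl, hkpos.le⟩
    have h2 := hf.rho_std_vert (Sub.right B) (p := 0) ⟨le_rfl, hkpos.le⟩
    rw [h0] at h1 h2
    simp only [vert, Bool.false_eq_true, if_false, if_true, add_zero, sub_zero] at h1 h2
    exact ⟨h1, h2⟩
  -- the element `f` moves a vertex of `J_n` only if the letter fixes it or it is the last one
  have hmoved : ∀ B p, rho (std α (n + 1) B) f p ≠ p → step (std α (n + 1) B) z.toGen p = p ∨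
      ∃ s r, Sub α n B .J s r ∧ p = vert s r k := by
    intro B p hp
    obtain ⟨s, r, p', hs, hp', rfl, hm⟩ := exists_sub_of_moved hf hI hp
    rcases hσ p' hm with rfl | ⟨h1, h2, h3, h4⟩
    · exact Or.inr ⟨s, r, hs, rfl⟩
    · left
      rw [step_vert_of_inner hs _ ⟨h1, h2⟩, step_of_notMem h3 h4]
  -- the letter fixes the last vertex of a copy of `J_n`, if it is not in the connector
  have hlastfix : ∀ B s r, Sub α n B .J s r → z.toGen ∉ view (std α (n + 1) B) s r k →
      step (std α (n + 1) B) z.toGen (vert s r k) = vert s r k := by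
    intro B s r hs hk'
    rw [← step_view (disj_std _ _), step_of_notMem hk']
    rw [(hs.reads (reads_std (n + 1) B)).eq_ofList (by omega)
      (by show k - 1 < len α n .J; omega)]
    exact hlast
  refine mem_real.mpr ⟨FreeGroup.of z.toGen * f * (FreeGroup.of z.toGen)⁻¹ * f⁻¹,
    Subgroup.mem_top _, (hf.succ.conj_of hend _).mul hf.succ.inv, ?_, ?_⟩
  · have hdisj : Perm.Disjoint (rho (std α (n + 1) .I) (FreeGroup.of z.toGen))
        (rho (std α (n + 1) .I) f) := by
      intro p
      by_cases hp : rho (std α (n + 1) .I) f p = p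
      · exact Or.inr hp
      left
      rw [rho_of hdI]
      rcases hmoved .I p hp with h | ⟨s, r, hs, rfl⟩
      · exact h
      · apply hlastfix _ _ _ hs
        have hr := reads_I_succ (reads_std (α := α) (n + 1) .I)
        have : view (std α (n + 1) .I) s r k = conn n := by
          cases hs with
          | left => simpa [view] using hr.2.1
          | right =>
            rw [← hr.2.1]
            simp only [view, if_true, len_I_succ]
            congr 1; ring
        rw [this]
        exact toGen_notMem_conn z n
    have := hdisj.commute
    simp only [map_mul, map_inv, this.eq]
    group
  · set θ := rho (std α (n + 1) .J) f
    set Z := rho (std α (n + 1) .J) (FreeGroup.of z.toGen)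
    have hEv : std α (n + 1) .J (v - 1) = {z.toGen} := (std_J_succ_end n).1.trans hz
    have hZv : Z v = v - 1 := by
      rw [rho_of hdJ, step_of_mem_pred hdJ (by rw [hEv]; simp)]
    have hθv : θ v = v + 1 := by
      have := hf.rho_std_vert (Sub.right .J) (p := k) ⟨hkpos.le, le_rfl⟩
      rw [hk] at this
      simp only [vert, if_true] at this
      rw [show v = K - k from rfl, this]; ring
    have hθv' : θ (v - 1) = v - 1 := by
      obtain ⟨i, hi, hi'⟩ := tail_length_cast (α := α) n
      have := hf.rho_std_vert (Sub.mid i hi) (p := len α n .I) ⟨hlpos.le, le_rfl⟩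
      rw [hI] at this
      simp only [vert, Bool.false_eq_true, if_false, Perm.one_apply] at this
      have e : v - 1 = k + 1 + i * (len α n .I + 1) + len α n .I := by
        rw [hv, hK, len_J_succ, hi']; ring
      rw [e]; exact this
    have hdisj : Perm.Disjoint (swap v (v - 1) * Z) θ := by
      intro p
      by_cases hp : θ p = p
      · exact Or.inr hp
      left
      have hpv' : p ≠ v - 1 := by rintro rfl; exact hp hθv'
      rw [Perm.mul_apply]
      by_cases hpv : p = v
      · rw [hpv, hZv, swap_apply_right]
      have hZp : Z p = p := by
        rw [rho_of hdJ]
        rcases hmoved .J p hp with h | ⟨s, r, hs, rfl⟩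
        · exact h
        · apply hlastfix _ _ _ hs
          cases hs with
          | left =>
            have := (reads_J_succ (reads_std (α := α) (n + 1) .J)).2.1
            rw [view_zero_false, this]
            exact hz'
          | right => exact absurd (by simp [vert, hv, hK]) hpv
      rw [hZp, swap_apply_of_ne_of_ne hpv hpv']
    have hc : Z * θ * Z⁻¹ = swap v (v - 1) * θ * swap v (v - 1) := by
      have h1 := hdisj.commute.eq
      have h2 : Z * θ = swap v (v - 1) * θ * swap v (v - 1) * Z := by
        rw [mul_assoc _ _ Z, mul_assoc _ θ, ← h1, ← mul_assoc, ← mul_assoc, swap_mul_self, one_mul]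
      rw [h2]; group
    simp only [map_mul, map_inv]
    change Z * θ * Z⁻¹ * θ⁻¹ = _
    rw [hc, mul_assoc _ θ, mul_swap_eq_swap_mul, hθv, hθv', mul_assoc, mul_inv_cancel_right]

/-- Conjugating a cycle of length three by the generators one obtains the alternating group
of `J_{n+1}`. -/
theorem swapFull_of_start {n : ℕ} (h : swap (len α (n + 1) .J - len α n .J)
      (len α (n + 1) .J - len α n .J - 1) *
      swap (len α (n + 1) .J - len α n .J + 1) (len α (n + 1) .J - len α n .J - 1) ∈
      real α (n + 1) ⊤) :
    SwapFull (real α (n + 1) ⊤) (Set.Icc 0 (len α (n + 1) .J)) := by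
  obtain ⟨z, hz, -⟩ := (α n).last_tail
  have hza := toGen_notMem_aSet z
  obtain ⟨hE1, hE2, hE3⟩ := std_J_succ_end (α := α) n
  have hk2 := le_len (α := α) n .J
  have hl2 := le_len (α := α) n .I
  have hKge := len_J_succ_ge (α := α) n
  have e1 := hE2 (len α n .J - 1) (by omega) (by omega)
  have e2 := hE2 (len α n .J - 2) (by omega) (by omega)
  have e3 := hE3 (len α n .I - 1) (by omega) (by omega)
  rw [hz] at hE1
  set k := len α n .J
  set K := len α (n + 1) .J with hK
  set w := std α (n + 1) .J with hw
  have hd : Disj w := disj_std _ _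
  -- a generator labeling the second edge after the last connector, but no edge nearby
  obtain ⟨g, hg1, hg2, hg3, hg4⟩ : ∃ g ∈ aSet, g ∈ w (K - k + 1) ∧
      g ∉ w (K - k) ∧ g ∉ w (K - k - 2) := by
    rw [show K - (k - 1) - 1 = K - k by ring] at e1
    rw [show K - (k - 2) - 1 = K - k + 1 by ring] at e2
    rw [show K - k - 1 - len α n .I + (len α n .I - 1) = K - k - 2 by ring] at e3
    rw [e1, e2, e3]
    rcases Nat.eq_zero_or_pos n with rfl | hn
    · refine ⟨.a0, by decide, ?_⟩
      have hI1 : std α 0 .I 1 = {.a1} := rfl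
      simp only [k, len_zero, sub_self, show (2 : ℤ) - 1 = 1 by rfl, (std_J_first 0).1,
        (std_J_first 0).2, hI1]
      decide
    · obtain ⟨hJ1, hJ2⟩ := std_last (blk_ends (α := α) hn .J).2
      obtain ⟨hI1, hI2⟩ := std_last (blk_ends (α := α) hn .I).2
      refine ⟨.a2, by decide, ?_⟩
      rw [hJ1, hJ2, hI2]
      decide
  have hg0 : g ∉ w (K - k - 1) := by
    rw [hE1, Finset.mem_singleton]
    rintro rfl
    exact hza hg1
  set v := K - k with hv
  have hconj : ∀ {p q b : ℤ}, (0 < p ∧ p < K) → (0 < q ∧ q < K) → (0 < b ∧ b < K) →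
      swap p q * swap q b ∈ real α (n + 1) ⊤ → ∀ g, swap (step w g p) (step w g q) *
        swap (step w g q) (step w g b) ∈ real α (n + 1) ⊤ :=
    fun hp hq hb => real_conj_swap hp hq hb
  rw [swap_comm (v + 1)] at h
  have T2 := (swapFull_pair (R := real α (n + 1) ⊤) v (v - 1)).insert (by simp) (by simp)
    (by omega) h
  have h' := hconj ⟨by omega, by omega⟩ ⟨by omega, by omega⟩ ⟨by omega, by omega⟩ h g
  rw [step_of_notMem hg3 hg0, step_of_notMem hg0 (by rwa [sub_sub, show (1 : ℤ) + 1 = 2 by rfl]),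
    step_of_mem hg2] at h'
  have T3 := (T2.insert (by simp) (by simp) (by omega) h').mono
    (T' := Set.Icc (v - 1) (v + 2)) (by
      intro p hp
      simp only [Set.mem_Icc, Set.mem_insert_iff, Set.mem_singleton_iff] at hp ⊢
      omega)
  have hright : ∀ b, v + 2 ≤ b → b ≤ K → SwapFull (real α (n + 1) ⊤) (Set.Icc (v - 1) b) := by
    intro b hb
    induction b, hb using Int.leInduction with
    | base => exact fun _ => T3
    | succ b hb ih =>
      intro hbK
      have T := ih (by omega)
      obtain ⟨g, hg⟩ := std_nonempty (α := α) (n + 1) .J (p := b) (by omega) (by omega)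
      have h1 := step_sub_le w g v
      have h2 := step_sub_le w g (v + 1)
      rw [abs_le] at h1 h2
      have hm := hconj (p := v) (q := v + 1) (b := b) ⟨by omega, by omega⟩ ⟨by omega, by omega⟩
        ⟨by omega, by omega⟩ (T _ (by simp; omega) _ (by simp; omega) _ (by simp; omega) _
          (by simp; omega) (by omega) (by omega)) g
      have hne : step w g v ≠ step w g (v + 1) := fun e => by
        have := (hd.step_involutive g).injective e; omega
      rw [step_of_mem (n := b) hg] at hm
      refine (T.insert (by simp; omega) (by simp; omega) hne hm).mono ?_
      intro p hp
      simp only [Set.mem_Icc, Set.mem_insert_iff] at hp ⊢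
      omega
  have hleft : ∀ a, a ≤ v - 1 → 0 ≤ a → SwapFull (real α (n + 1) ⊤) (Set.Icc a K) := by
    intro a ha
    induction a, ha using Int.leInductionDown with
    | base => exact fun _ => hright K (by omega) le_rfl
    | pred a ha ih =>
      intro ha0
      have T := ih (by omega)
      obtain ⟨g, hg⟩ := std_nonempty (α := α) (n + 1) .J (p := a - 1) (by omega) (by omega)
      have h1 := step_sub_le w g (K - 1)
      have h2 := step_sub_le w g (K - 2)
      rw [abs_le] at h1 h2
      have hm := hconj (p := K - 1) (q := K - 2) (b := a) ⟨by omega, by omega⟩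
        ⟨by omega, by omega⟩ ⟨by omega, by omega⟩ (T _ (by simp; omega) _ (by simp; omega) _
          (by simp; omega) _ (by simp; omega) (by omega) (by omega)) g
      have hne : step w g (K - 1) ≠ step w g (K - 2) := fun e => by
        have := (hd.step_involutive g).injective e; omega
      rw [step_of_mem_pred hd (n := a) hg] at hm
      refine (T.insert (by simp; omega) (by simp; omega) hne hm).mono ?_
      intro p hp
      simp only [Set.mem_Icc, Set.mem_insert_iff] at hp ⊢
      omega
  exact hleft 0 (by omega) le_rfl

/-- The even permutations of the vertices of `J_n` are induced by local elements acting trivially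
on `I_n`. -/
theorem swapFull_real {n : ℕ} (hn : 1 ≤ n) :
    SwapFull (real α n ⊤) (Set.Icc 0 (len α n .J)) := by
  induction n, hn using Nat.le_induction with
  | base =>
    obtain ⟨z, hz, hz'⟩ := (α 0).last_tail
    have hza := toGen_notMem_aSet z
    have hJ := disj_std (α := α) 0 .J
    have e0 := (std_J_first (α := α) 0).1
    have e1 := (std_J_first (α := α) 0).2
    have hmem : ∀ p, Gen.a2 ∈ std α 0 .J p → p = 1 := by
      intro p hp
      have h0 : 0 ≤ p := by
        by_contra h
        simp [std_neg 0 Block.J (not_le.mp h)] at hp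
      have h2 : p < 2 := by
        by_contra h
        rw [std_ge 0 Block.J (by rw [len_zero]; omega)] at hp
        simp at hp
      interval_cases p
      · rw [e0] at hp
        exact absurd hp (by decide)
      · rfl
    refine swapFull_of_start (start_mem_real hz hz' (f := FreeGroup.of .a2)
      (local_of_mem_aSet 0 (by decide)) ?_ ?_ ?_ ?_)
    · ext p
      have hmem' : ∀ p, Gen.a2 ∉ std α 0 .I p := by
        intro p hp
        have h0 : 0 ≤ p := by
          by_contra h
          simp [std_neg 0 Block.I (not_le.mp h)] at hp
        have h2 : p < 2 := by
          by_contra h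
          rw [std_ge 0 Block.I (by rw [len_zero]; omega)] at hp
          simp at hp
        interval_cases p
        · exact absurd hp (by decide : Gen.a2 ∉ ({.a0} : Finset Gen))
        · exact absurd hp (by decide : Gen.a2 ∉ ({.a1} : Finset Gen))
      rw [rho_of (disj_std _ _), step_of_notMem (hmem' _) (hmem' _), Perm.one_apply]
    · intro p hp
      rw [rho_of hJ] at hp
      by_cases h1 : Gen.a2 ∈ std α 0 .J p
      · obtain rfl := hmem p h1
        right
        rw [len_zero, e1, sub_self, e0]
        exact ⟨by omega, by omega, fun h => hza (by simp at h; rw [h]; decide),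
          fun h => hza (by simp at h; rw [h]; decide)⟩
      · by_cases h2 : Gen.a2 ∈ std α 0 .J (p - 1)
        · left
          have := hmem _ h2
          rw [len_zero]; omega
        · exact absurd (step_of_notMem h1 h2) hp
    · rw [rho_of hJ, step_of_mem_pred hJ (by rw [len_zero, show (2 : ℤ) - 1 = 1 by rfl, e1]; simp)]
    · rw [len_zero, show (2 : ℤ) - 1 = 1 by rfl, e1]
      exact fun h => hza (by simp at h; rw [h]; decide)
  | succ n hn ih =>
    obtain ⟨z, hz, hz'⟩ := (α n).last_tail
    have hza := toGen_notMem_aSet z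
    obtain ⟨hJ1, hJ2⟩ := std_last (blk_ends (α := α) hn .J).2
    obtain ⟨hF1, hF2⟩ := std_J_first (α := α) n
    have hza0 : z.toGen ∉ ({.a0} : Finset Gen) := fun h => hza (by simp at h; rw [h]; decide)
    have hza2 : z.toGen ∉ ({.a2} : Finset Gen) := fun h => hza (by simp at h; rw [h]; decide)
    have hk := len_J_lt_succ (α := α) (n - 1) .J
    have hk' := le_len (α := α) (n - 1) .J
    rw [Nat.sub_add_cancel hn] at hk
    obtain ⟨f, _, hf, hI, hσ⟩ := mem_real.mp (ih (len α n .J) (by simp; omega) (len α n .J - 1)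
      (by simp; omega) (len α n .J - 1) (by simp; omega) 1 (by simp; omega) (by omega) (by omega))
    refine swapFull_of_start (start_mem_real hz hz' hf hI ?_ ?_ ?_)
    · intro p hp
      rw [hσ, Perm.mul_apply] at hp
      by_cases h1 : p = len α n .J
      · exact Or.inl h1
      right
      by_cases h2 : p = len α n .J - 1
      · subst h2
        rw [hJ2, sub_sub, show (1 : ℤ) + 1 = 2 by rfl, hJ1]
        exact ⟨by omega, by omega, hza0, hza2⟩
      by_cases h3 : p = 1
      · subst h3
        rw [sub_self, hF1, hF2]
        exact ⟨by omega, by omega, hza2, hza0⟩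
      · rw [swap_apply_of_ne_of_ne h2 h3, swap_apply_of_ne_of_ne h1 h2] at hp
        exact absurd rfl hp
    · rw [hσ, Perm.mul_apply, swap_apply_of_ne_of_ne (a := len α n .J - 1) (by omega) (by omega),
        swap_apply_left]
    · rw [hJ2]; exact hza0

/-! ### Parity of the action of local elements -/

section Parity

/-- The finitary alternating group of the interval `{0, …, K}`. -/
def altPerm (K : ℤ) : Subgroup (Perm ℤ) :=
  Subgroup.closure {τ | ∃ a ∈ Set.Icc 0 K, ∃ b ∈ Set.Icc 0 K, ∃ c ∈ Set.Icc 0 K,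
    ∃ d ∈ Set.Icc 0 K, a ≠ b ∧ c ≠ d ∧ τ = swap a b * swap c d}

theorem altPerm_le {K : ℤ} {R : Subgroup (Perm ℤ)} : altPerm K ≤ R ↔ SwapFull R (Set.Icc 0 K) := by
  rw [altPerm, Subgroup.closure_le]
  constructor
  · intro h a ha b hb c hc d hd hab hcd
    exact h ⟨a, ha, b, hb, c, hc, d, hd, hab, hcd, rfl⟩
  · rintro h _ ⟨a, ha, b, hb, c, hc, d, hd, hab, hcd, rfl⟩
    exact h a ha b hb c hc d hd hab hcd

theorem swapFull_altPerm (K : ℤ) : SwapFull (altPerm K) (Set.Icc 0 K) := altPerm_le.mp le_rfl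

theorem conj_mem_altPerm {l K : ℤ} (t : Perm ℤ) (ht : ∀ p ∈ Set.Icc 0 l, t p ∈ Set.Icc 0 K)
    {τ : Perm ℤ} (hτ : τ ∈ altPerm l) : t * τ * t⁻¹ ∈ altPerm K := by
  have : altPerm l ≤ (altPerm K).comap (MulAut.conj t).toMonoidHom := by
    rw [altPerm_le]
    intro a ha b hb c hc d hd hab hcd
    change t * (swap a b * swap c d) * t⁻¹ ∈ altPerm K
    rw [conj_swap_mul_swap]
    exact swapFull_altPerm K _ (ht a ha) _ (ht b hb) _ (ht c hc) _ (ht d hd)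
      (t.injective.ne hab) (t.injective.ne hcd)
  exact this hτ

/-- A permutation of an interval together with its copy on a disjoint reflected interval is
an even permutation. -/
theorem mul_reflect_mem_altPerm {k K : ℤ} (hK : 2 * k + 1 ≤ K) {σ : Perm ℤ}
    (hσ : ∀ p, p ∉ Set.Icc 0 k → σ p = p) :
    σ * (Equiv.subLeft K * σ * (Equiv.subLeft K)⁻¹) ∈ altPerm K := by
  have hsub : ∀ p, σ p ∈ Set.Icc 0 k ↔ p ∈ Set.Icc 0 k := by
    intro p
    constructor
    · intro h
      by_contra hp
      rw [hσ p hp] at h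
      exact hp h
    · intro h
      by_contra hp
      exact hp (by rwa [σ.injective (hσ _ hp)])
  have e : Perm.ofSubtype (σ.subtypePerm hsub) = σ :=
    Perm.ofSubtype_subtypePerm hsub (fun p hp => by
      by_contra h
      exact hp (hσ p h))
  rw [← e]
  generalize σ.subtypePerm hsub = τ
  induction τ using Perm.swap_induction_on with
  | one => simp
  | swap_mul f x y hxy ih =>
    set F := Perm.ofSubtype f with hF
    set c : Perm ℤ := Equiv.subLeft K with hc
    have hs : Perm.ofSubtype (swap x y) = swap (x : ℤ) y := by simp
    have hcs : c * swap (x : ℤ) y * c⁻¹ = swap (c x) (c y) := by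
      rw [mul_swap_eq_swap_mul, mul_inv_cancel_right]
    have hx := x.2
    have hy := y.2
    simp only [Set.mem_Icc] at hx hy
    have hcx : c x = K - x := by simp [hc]
    have hcy : c y = K - y := by simp [hc]
    have hcomm : F * swap (c x) (c y) = swap (c x) (c y) * F := by
      apply Commute.eq
      apply Perm.Disjoint.commute
      intro p
      by_cases hp : p ∈ Set.Icc 0 k
      · right
        simp only [Set.mem_Icc] at hp
        exact swap_apply_of_ne_of_ne (by omega) (by omega)
      · left
        exact Perm.ofSubtype_apply_of_not_mem f hp
    have hsw := swapFull_altPerm K x ⟨by omega, by omega⟩ y ⟨by omega, by omega⟩ (c x)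
      ⟨by omega, by omega⟩ (c y) ⟨by omega, by omega⟩ (by simpa [Subtype.ext_iff] using hxy)
      (c.injective.ne (by simpa [Subtype.ext_iff] using hxy))
    have := (altPerm K).mul_mem hsw ih
    rw [map_mul, hs, ← hF]
    convert this using 1
    calc swap (x : ℤ) y * F * (c * (swap (x : ℤ) y * F) * c⁻¹)
        = swap (x : ℤ) y * (F * (c * swap (x : ℤ) y * c⁻¹)) * (c * F * c⁻¹) := by group
      _ = swap (x : ℤ) y * swap (c x) (c y) * (F * (c * F * c⁻¹)) := by
        rw [hcs, hcomm]; group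

theorem exists_copies {l K s : ℤ} {τ : Perm ℤ} (hτ : τ ∈ altPerm l)
    (hτ' : ∀ p, p ∉ Set.Icc 0 l → τ p = p) (hl : 0 ≤ l) (hs : 0 ≤ s) : ∀ m : ℕ,
    s + m * (l + 1) ≤ K + 1 → ∃ P ∈ altPerm K, (∀ p, p < s ∨ s + m * (l + 1) ≤ p → P p = p) ∧
      ∀ i : ℕ, i < m → ∀ p ∈ Set.Icc 0 l, P (s + i * (l + 1) + p) = s + i * (l + 1) + τ p := by
  intro m
  induction m with
  | zero => exact fun _ => ⟨1, Subgroup.one_mem _, by simp, by simp⟩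
  | succ m ih =>
    intro hK
    push_cast at hK
    have hm : 0 ≤ (m : ℤ) * (l + 1) := by positivity
    obtain ⟨P, hP, h1, h2⟩ := ih (by linarith)
    set u := s + m * (l + 1) with hu
    have hu' : s + ((m : ℤ) + 1) * (l + 1) = u + l + 1 := by rw [hu]; ring
    have happ : ∀ p, (Equiv.addRight u * τ * (Equiv.addRight u)⁻¹ : Perm ℤ) p = τ (p - u) + u := by
      intro p; simp [sub_eq_add_neg]
    have hτmem : ∀ p ∈ Set.Icc 0 l, τ p ∈ Set.Icc 0 l := by
      intro p hp
      by_contra h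
      exact h (by rwa [τ.injective (hτ' _ h)])
    refine ⟨P * (Equiv.addRight u * τ * (Equiv.addRight u)⁻¹), Subgroup.mul_mem _ hP
      (conj_mem_altPerm _ ?_ hτ), ?_, ?_⟩
    · rintro p ⟨hp0, hp1⟩
      simp only [Equiv.coe_addRight, Set.mem_Icc]
      constructor <;> linarith
    · intro p hp
      push_cast at hp
      rw [hu'] at hp
      rw [Perm.mul_apply, happ, hτ' _ (by simp only [Set.mem_Icc]; omega), sub_add_cancel]
      exact h1 p (by omega)
    · intro i hi p hp
      rcases Nat.lt_succ_iff_lt_or_eq.mp hi with hi' | rfl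
      · have hle : s + i * (l + 1) + p < u := by
          have : ((i : ℤ) + 1) * (l + 1) ≤ m * (l + 1) :=
            mul_le_mul_of_nonneg_right (by omega) (by omega)
          have := hp.2
          linarith
        rw [Perm.mul_apply, happ, hτ' _ (by simp only [Set.mem_Icc]; omega), sub_add_cancel]
        exact h2 i hi' p hp
      · rw [Perm.mul_apply, happ]
        have := hτmem p hp
        simp only [Set.mem_Icc] at this
        rw [show s + i * (l + 1) + p - u = p by rw [hu]; ring, h1 _ (by omega), hu]
        ring

end Parity

theorem rho_std_notMem_Icc (n : ℕ) (B : Block) (f : FreeGroup Gen) (p : ℤ)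
    (hp : p ∉ Set.Icc 0 (len α n B)) : rho (std α n B) f p = p :=
  rho_std_of_notMem n B f hp

/-- A local element acts on `I_{n+1}` by an even permutation, as it acts in the same way on the two
copies of `J_n`. -/
theorem Local.mem_altPerm_I {n : ℕ} {f : FreeGroup Gen} (hf : Local α n f) :
    rho (std α (n + 1) .I) f ∈ altPerm (len α (n + 1) .I) := by
  have hK := len_I_succ (α := α) n
  convert mul_reflect_mem_altPerm hK.ge (rho_std_notMem_Icc n .J f) using 1
  ext p
  set σ := rho (std α n .J) f
  have hσ : ∀ p, p ∉ Set.Icc 0 (len α n .J) → σ p = p := rho_std_notMem_Icc n .J f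
  have happ : ∀ K : ℤ, (Equiv.subLeft K * σ * (Equiv.subLeft K)⁻¹ : Perm ℤ) p = K - σ (K - p) := by
    intro K; simp [neg_add_eq_sub]
  rw [Perm.mul_apply, happ]
  rcases lt_or_ge (len α n .J) p with h1 | h1
  · by_cases h2 : p ≤ len α (n + 1) .I
    · have := hf.rho_std_vert (Sub.right .I) (p := len α (n + 1) .I - p) ⟨by omega, by omega⟩
      simp only [vert, if_true, sub_sub_cancel] at this
      have hm := rho_std_mem (α := α) n .J f (p := len α (n + 1) .I - p) ⟨by omega, by omega⟩
      rw [this, hσ (len α (n + 1) .I - σ (len α (n + 1) .I - p)) (by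
        simp only [Set.mem_Icc, σ]
        omega)]
    · rw [rho_std_of_notMem _ _ _ (by omega), hσ (len α (n + 1) .I - p)
        (by simp only [Set.mem_Icc]; omega), sub_sub_cancel,
        hσ p (by simp only [Set.mem_Icc]; omega)]
  · rw [hσ (len α (n + 1) .I - p) (by simp only [Set.mem_Icc]; omega), sub_sub_cancel]
    rcases lt_or_ge p 0 with h2 | h2
    · rw [rho_std_of_notMem _ _ _ (by omega), hσ p (by simp only [Set.mem_Icc]; omega)]
    · have := hf.rho_std_vert (Sub.left .I) (p := p) ⟨h2, h1⟩
      simpa [vert] using this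

/-- A local element acting evenly on `I_n` acts evenly on `J_{n+1}`. -/
theorem Local.mem_altPerm_J {n : ℕ} {f : FreeGroup Gen} (hf : Local α n f)
    (hI : rho (std α n .I) f ∈ altPerm (len α n .I)) :
    rho (std α (n + 1) .J) f ∈ altPerm (len α (n + 1) .J) := by
  have hK := len_J_succ (α := α) n
  have hK' := len_J_succ_ge (α := α) n
  have hk0 := len_pos (α := α) n .J
  have hl0 := len_pos (α := α) n .I
  obtain ⟨P, hP, hP1, hP2⟩ := exists_copies (K := len α (n + 1) .J) (s := len α n .J + 1) hI
    (rho_std_notMem_Icc n .I f) hl0.le (by omega) (α n).tail.length (by linarith)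
  set e := len α n .J + 1 + (α n).tail.length * (len α n .I + 1) with he
  have he' : len α (n + 1) .J = e + len α n .J := by rw [he, hK]; ring
  have heP : 0 ≤ ((α n).tail.length : ℤ) * (len α n .I + 1) := by positivity
  have hKe : 2 * len α n .J + 1 ≤ len α (n + 1) .J := by linarith
  have hD := mul_reflect_mem_altPerm hKe (rho_std_notMem_Icc n .J f)
  convert Subgroup.mul_mem _ hP hD using 1
  ext p
  set σ := rho (std α n .J) f
  set k := len α n .J
  set K := len α (n + 1) .J
  have hσ : ∀ p, p ∉ Set.Icc 0 k → σ p = p := rho_std_notMem_Icc n .J f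
  have hσm : ∀ p, 0 ≤ p ∧ p ≤ k → 0 ≤ σ p ∧ σ p ≤ k := fun p hp => rho_std_mem n .J f hp
  have happ : (Equiv.subLeft K * σ * (Equiv.subLeft K)⁻¹ : Perm ℤ) p = K - σ (K - p) := by
    simp [neg_add_eq_sub]
  rw [Perm.mul_apply, Perm.mul_apply, happ]
  by_cases hp : 0 ≤ p ∧ p ≤ K
  · obtain ⟨B', s, r, p', hs, hp', rfl⟩ := exists_sub (α := α) .J hp
    rw [hf.rho_std_vert hs hp']
    cases hs with
    | left =>
      have := hσm p' hp'
      simp only [vert, Bool.false_eq_true, if_false, zero_add]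
      rw [hσ (K - p') (by simp only [Set.mem_Icc]; omega), sub_sub_cancel, hP1]
      left
      omega
    | right =>
      have := hσm p' hp'
      simp only [vert, if_true]
      rw [sub_sub_cancel, hσ (K - σ p') (by simp only [Set.mem_Icc]; omega), hP1]
      right
      omega
    | mid i hi =>
      have hi0 : 0 ≤ (i : ℤ) * (len α n .I + 1) := by positivity
      have hi1 : ((i : ℤ) + 1) * (len α n .I + 1) ≤ (α n).tail.length * (len α n .I + 1) :=
        mul_le_mul_of_nonneg_right (by omega) (by omega)
      simp only [vert, Bool.false_eq_true, if_false]
      rw [hσ (K - (k + 1 + i * (len α n .I + 1) + p'))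
          (by simp only [Set.mem_Icc]; rintro ⟨-, h⟩; linarith [hp'.2]),
        sub_sub_cancel, hσ _ (by simp only [Set.mem_Icc]; rintro ⟨-, h⟩; linarith [hp'.1]),
        hP2 i hi p' hp']
  · rw [rho_std_of_notMem _ _ _ hp, hσ (K - p) (by simp only [Set.mem_Icc]; omega), sub_sub_cancel,
      hσ p (by simp only [Set.mem_Icc]; omega), hP1 p (by omega)]

theorem Local.rho_succ_eq_one {n : ℕ} {f : FreeGroup Gen} (hf : Local α n f) {B : Block}
    (h : ∀ B' s r, Sub α n B B' s r → rho (std α n B') f = 1) : rho (std α (n + 1) B) f = 1 := by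
  ext p
  by_cases hp : 0 ≤ p ∧ p ≤ len α (n + 1) B
  · obtain ⟨B', s, r, p', hs, hp', rfl⟩ := exists_sub (α := α) B hp
    rw [hf.rho_std_vert hs hp', h B' s r hs, Perm.one_apply, Perm.one_apply]
  · rw [rho_std_of_notMem _ _ _ hp, Perm.one_apply]

theorem Local.rho_I_succ_eq_one {n : ℕ} {f : FreeGroup Gen} (hf : Local α n f)
    (h : rho (std α n .J) f = 1) : rho (std α (n + 1) .I) f = 1 :=
  hf.rho_succ_eq_one (by rintro _ _ _ (_ | _) <;> exact h)

theorem Local.rho_eq_one {n m : ℕ} (hnm : n ≤ m) {f : FreeGroup Gen} (hf : Local α n f)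
    (h : ∀ B, rho (std α n B) f = 1) : ∀ B, rho (std α m B) f = 1 := by
  induction m, hnm using Nat.le_induction with
  | base => exact h
  | succ m hm ih => exact fun B => (hf.mono hm).rho_succ_eq_one (fun B' _ _ _ => ih B')

/-! ### The group and its free cover -/

/-- The homomorphism from the free group onto the group `G_α`. -/
noncomputable def toG (α : ℕ → Symb) : FreeGroup Gen →* G α :=
  FreeGroup.lift fun h => ⟨labelPerm (shift α) (shift_admissible α) h,
    Subgroup.subset_closure ⟨h, rfl⟩⟩

theorem toG_of (h : Gen) :
    (toG α (FreeGroup.of h) : Perm (shift α × ℤ)) = labelPerm (shift α) (shift_admissible α) h := by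
  simp [toG]

theorem toG_surjective : Function.Surjective (toG α) := by
  rintro ⟨g, hg⟩
  have h : G α ≤ (toG α).range.map (G α).subtype := by
    refine (Subgroup.closure_le _).mpr ?_
    rintro _ ⟨h, rfl⟩
    exact ⟨toG α (FreeGroup.of h), ⟨_, rfl⟩, toG_of h⟩
  obtain ⟨_, ⟨f, rfl⟩, hf⟩ := h hg
  exact ⟨f, Subtype.ext hf⟩

theorem shift_disj {w : ℤ → Finset Gen} (hw : w ∈ shift α) : Disj w :=
  (shift_admissible α w hw).disj

theorem toG_apply (f : FreeGroup Gen) : ∀ (w : shift α) (i : ℤ),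
    (toG α f : Perm (shift α × ℤ)) (w, i) = (w, rho w.1 f i) := by
  induction f using freeGroup_induction with
  | one => simp
  | of h => intro w i; rw [toG_of, rho_of (shift_disj w.2)]; rfl
  | inv h ih =>
    intro w i
    rw [rho_of_inv (shift_disj w.2), ← ih w i]
    have : toG α (FreeGroup.of h) * toG α (FreeGroup.of h) = 1 := by
      apply Subtype.ext
      rw [Subgroup.coe_mul, toG_of]
      ext1 p
      exact Function.Involutive.toPerm_involutive _ p
    rw [map_inv, inv_eq_of_mul_eq_one_left this]
  | mul f g hf hg => intro w i; simp [hf, hg]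

theorem toG_eq_one_iff {f : FreeGroup Gen} :
    toG α f = 1 ↔ ∀ w ∈ shift α, ∀ i, rho w f i = i := by
  constructor
  · intro h w hw i
    have := toG_apply f ⟨w, hw⟩ i
    rw [h] at this
    simpa using this.symm
  · intro h
    apply Subtype.ext
    ext1 ⟨w, i⟩
    rw [toG_apply, h _ w.2]
    rfl

theorem blk_infix_succ (n : ℕ) (B : Block) : blk α n B <:+: blk α (n + 1) .J := by
  rw [blk_J_succ]
  cases B with
  | J => exact (((List.prefix_append _ _).trans (List.prefix_append _ _)).trans
      (List.prefix_append _ _)).isInfix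
  | I =>
    obtain ⟨A, t, ht⟩ := List.exists_cons_of_ne_nil (α n).tail_ne_nil
    rw [ht]
    refine ⟨blk α n .J ++ [(α n).head],
      [A] ++ t.flatMap (fun A => blk α n .I ++ [A]) ++ (blk α n .J).reverse, ?_⟩
    simp

theorem blk_infix {n m : ℕ} (hnm : n < m) (B : Block) : blk α n B <:+: blk α m .J := by
  induction m, hnm using Nat.le_induction with
  | base => exact blk_infix_succ n B
  | succ m _ ih => exact ih.trans (blk_infix_succ m .J)

theorem subword_eq {S : Type} (w : ℤ → Finset S) (i : ℤ) (k : ℕ) :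
    subword w i k = (List.range k).map fun j : ℕ => w (i + j) := by
  simp [subword, List.bind_eq_flatMap, ← List.map_eq_flatMap]

/-- Any neighborhood of any vertex of a graph in the subshift is found in all long blocks `J_m`. -/
theorem exists_window {w : ℤ → Finset Gen} (hw : w ∈ shift α) (i : ℤ) (R : ℕ) :
    ∃ m₁, ∀ m, m₁ ≤ m → ∃ j : ℤ, R ≤ j ∧ j + R ≤ len α m .J ∧
      ∀ t : ℤ, |t| ≤ R → w (i + t) = std α m .J (j + t) := by
  obtain ⟨u, ⟨n, hu⟩, hinf⟩ := hw (i - R) (2 * R + 1)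
  obtain ⟨B, rfl⟩ : ∃ B, u = blk α n B := by
    rcases hu with h | h
    · exact ⟨.I, h⟩
    · exact ⟨.J, h⟩
  refine ⟨n + 1, fun m hm => ?_⟩
  obtain ⟨s, t, hst⟩ := hinf.trans (blk_infix hm B)
  have hr := reads_std (α := α) m .J
  have hlen : len α m .J = s.length + (2 * R + 1) + t.length := by
    rw [len, ← hst]; simp [subword_eq, add_assoc]
  rw [← hst, reads_append, reads_append, zero_add] at hr
  have hr' := reads_iff.mp hr.1.2
  refine ⟨s.length + R, by omega, by omega, fun q hq => ?_⟩
  rw [abs_le] at hq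
  obtain ⟨a, ha⟩ := Int.eq_ofNat_of_zero_le (show 0 ≤ R + q by omega)
  have := hr' a (by simp [subword_eq]; omega)
  rw [show (s.length : ℤ) + R + q = s.length + a by omega, this,
    List.getD_eq_getElem _ _ (by simp [subword_eq]; omega)]
  simp only [subword_eq, List.getElem_map, List.getElem_range]
  congr 1
  omega

/-- A local element is determined as an element of `G_α` by its action on the blocks. -/
theorem Local.toG_eq_one {n : ℕ} {f : FreeGroup Gen} (hf : Local α n f)
    (h : ∀ B, rho (std α n B) f = 1) : toG α f = 1 := by
  rw [toG_eq_one_iff]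
  intro w hw i
  obtain ⟨R, hR⟩ := exists_radius f
  obtain ⟨m₁, hm₁⟩ := exists_window hw i R
  obtain ⟨j, -, -, hj⟩ := hm₁ (max m₁ n) (le_max_left _ _)
  have := rho_shift_eq (shift_disj hw) (disj_std _ _) hR hj
  rw [hf.rho_eq_one (le_max_right m₁ n) h .J] at this
  simpa [sub_eq_zero] using this

/-- If a subgroup of the free group containing the kernel contains local elements inducing all even
permutations of `J_m`, then it contains all such elements. -/
theorem mem_of_swapFull {M : Subgroup (FreeGroup Gen)} (hker : ∀ f, toG α f = 1 → f ∈ M) {m : ℕ}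
    (hM : SwapFull (real α m M) (Set.Icc 0 (len α m .J))) {f : FreeGroup Gen} (hf : Local α m f)
    (hI : rho (std α m .I) f = 1) (hJ : rho (std α m .J) f ∈ altPerm (len α m .J)) : f ∈ M := by
  obtain ⟨g, hg, hgl, hgI, hgJ⟩ := mem_real.mp (altPerm_le.mpr hM hJ)
  have h := hker (f * g⁻¹) ((hf.mul hgl.inv).toG_eq_one (by
    rintro (_ | _)
    · simp [hI, hgI]
    · simp [hgJ]))
  simpa using M.mul_mem h hg

/-- A subgroup of the free group which contains the kernel and the local alternating groups of all
sufficiently big generations contains all local elements. Namely, two generations up a local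
element acts evenly on both blocks; a correction in the local alternating group makes the action
on `J_m` trivial, and then one generation up the action on the block `I` is trivial, and the action
on the block `J` is even. -/
theorem Local.mem_of_swapFull {M : Subgroup (FreeGroup Gen)} (hker : ∀ f, toG α f = 1 → f ∈ M)
    {m₀ : ℕ} (hM : ∀ m, m₀ ≤ m → SwapFull (real α m M) (Set.Icc 0 (len α m .J)))
    {n : ℕ} {f : FreeGroup Gen} (hf : Local α n f) : f ∈ M := by
  set m := max m₀ n
  have h1 : Local α m f := hf.mono (le_max_right _ _)
  have hJ := h1.succ.mem_altPerm_J h1.mem_altPerm_I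
  have hm : m₀ ≤ m := le_max_left _ _
  obtain ⟨g, hg, hgl, hgI, hgJ⟩ := mem_real.mp (altPerm_le.mpr (hM (m + 2) (by omega)) hJ)
  have h2 : Local α (m + 2) (f * g⁻¹) := h1.succ.succ.mul hgl.inv
  have h2I : rho (std α (m + 2) .I) (f * g⁻¹) ∈ altPerm (len α (m + 2) .I) := by
    simpa [hgI] using h1.succ.mem_altPerm_I
  have h3 : f * g⁻¹ ∈ M := AlphaGroup.mem_of_swapFull hker (hM (m + 3) (by omega)) h2.succ
    (h2.rho_I_succ_eq_one (by simp [hgJ])) (h2.mem_altPerm_J h2I)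
  simpa using M.mul_mem h3 hg

/-! ### Normal subgroups contain the local alternating groups -/

theorem exists_fresh (S : Finset ℤ) {L : ℤ} (h : (S.card : ℤ) ≤ L) : ∃ d ∈ Set.Icc 0 L, d ∉ S := by
  have hc : S.card < (Finset.Icc 0 L).card := by
    rw [Int.card_Icc]
    omega
  obtain ⟨d, hd, hd'⟩ := Finset.exists_mem_notMem_of_card_lt_card hc
  exact ⟨d, by simpa using hd, hd'⟩

theorem exists_fresh_pair (S : Finset ℤ) {L : ℤ} (h : (S.card : ℤ) + 1 ≤ L) :
    ∃ d ∈ Set.Icc 0 L, ∃ e ∈ Set.Icc 0 L, d ∉ S ∧ e ∉ S ∧ d ≠ e := by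
  obtain ⟨d, hd, hdS⟩ := exists_fresh S (L := L) (by omega)
  obtain ⟨e, he, heS⟩ := exists_fresh (insert d S) (L := L)
    (by rw [Finset.card_insert_of_notMem hdS]; push_cast; omega)
  simp only [Finset.mem_insert, not_or] at heS
  exact ⟨d, hd, e, he, hdS, heS.2, fun h => heS.1 h.symm⟩

theorem commutator_mem_real {n : ℕ} {σ τ : Perm ℤ} (hσ : σ ∈ real α n ⊤) (hτ : τ ∈ real α n ⊤) :
    τ * σ * τ⁻¹ * σ⁻¹ ∈ real α n (commutator (FreeGroup Gen)) := by
  obtain ⟨f, -, hf, hfI, rfl⟩ := mem_real.mp hσ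
  obtain ⟨g, -, hg, hgI, rfl⟩ := mem_real.mp hτ
  refine mem_real.mpr ⟨g * f * g⁻¹ * f⁻¹, ?_, ((hg.mul hf).mul hg.inv).mul hf.inv, ?_, ?_⟩
  · exact Subgroup.commutator_mem_commutator (Subgroup.mem_top g) (Subgroup.mem_top f)
  · simp [hfI, hgI]
  · simp

/-- The local alternating groups are contained in the derived subgroup. -/
theorem swapFull_real_commutator {n : ℕ} (hn : 1 ≤ n) :
    SwapFull (real α n (commutator (FreeGroup Gen))) (Set.Icc 0 (len α n .J)) := by
  have hF := swapFull_real (α := α) hn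
  have hk := len_J_lt_succ (α := α) (n - 1) .J
  have hk' := le_len (α := α) (n - 1) .J
  rw [Nat.sub_add_cancel hn] at hk
  have h0 : (0 : ℤ) ∈ Set.Icc 0 (len α n .J) := ⟨by omega, by omega⟩
  have h1 : (1 : ℤ) ∈ Set.Icc 0 (len α n .J) := ⟨by omega, by omega⟩
  apply swapFull_of_fan (b := 0) (c := 1)
  intro e he he0 he1
  obtain ⟨d, hd, d', hd', hdS, hdS', hdd⟩ := exists_fresh_pair {0, 1, e} (L := len α n .J) (by
    have := Finset.card_le_three (a := (0 : ℤ)) (b := 1) (c := e)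
    omega)
  simp only [Finset.mem_insert, Finset.mem_singleton, not_or] at hdS hdS'
  -- conjugation by `τ` replaces the transposition of `0` and `1` by that of `e` and `1`
  set σ := swap 0 1 * swap d d' with hσ
  set τ := swap 0 e * swap d d' with hτ
  have := commutator_mem_real (hF 0 h0 1 h1 d hd d' hd' (by omega) hdd)
    (hF 0 h0 e he d hd d' hd' (Ne.symm he0) hdd)
  rw [conj_swap_mul_swap] at this
  have t0 : (swap 0 e * swap d d') 0 = e := by
    rw [Perm.mul_apply, swap_apply_of_ne_of_ne (a := d) (by tauto) (by tauto), swap_apply_left]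
  have t1 : (swap 0 e * swap d d') 1 = 1 := by
    rw [Perm.mul_apply, swap_apply_of_ne_of_ne (a := d) (by tauto) (by tauto),
      swap_apply_of_ne_of_ne (by omega) (Ne.symm he1)]
  have t2 : (swap 0 e * swap d d') d = d' := by
    rw [Perm.mul_apply, swap_apply_left, swap_apply_of_ne_of_ne (by tauto) (by tauto)]
  have t3 : (swap 0 e * swap d d') d' = d := by
    rw [Perm.mul_apply, swap_apply_right, swap_apply_of_ne_of_ne (by tauto) (by tauto)]
  rw [t0, t1, t2, t3, mul_inv_rev, swap_inv, swap_inv, swap_comm d' d, mul_assoc,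
    swap_mul_self_mul] at this
  have := Subgroup.inv_mem _ this
  rwa [mul_inv_rev, swap_inv, swap_inv, swap_comm e] at this

theorem Local.congr {n : ℕ} {f g : FreeGroup Gen} (hf : Local α n f)
    (h : ∀ w : ℤ → Finset Gen, Disj w → rho w g = rho w f) : Local α n g := by
  intro w O hO B s r hB p hp
  rw [h _ (hO.disj.view s r), h _ (disj_std n B)]
  exact hf w O hO B s r hB p hp

/-- A local element supported deep inside of the blocks `J_n` stays local when it is conjugated by
a given element of the group. -/
theorem exists_depth (f : FreeGroup Gen) : ∃ R : ℕ, ∀ (n : ℕ) (t : FreeGroup Gen), Local α n t →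
    rho (std α n .I) t = 1 →
    (∀ p : ℤ, p < R ∨ len α n .J - R < p → rho (std α n .J) t p = p) → Local α n (f * t * f⁻¹) := by
  have gen : ∀ h : Gen, ∀ (n : ℕ) (t : FreeGroup Gen), Local α n t →
      rho (std α n .I) t = 1 →
      (∀ p : ℤ, p < (1 : ℕ) ∨ len α n .J - (1 : ℕ) < p → rho (std α n .J) t p = p) →
      Local α n (FreeGroup.of h * t * (FreeGroup.of h)⁻¹) := by
    intro h n t ht hI hJ
    apply ht.conj_of
    rintro (_ | _)
    · simp [hI]
    · exact ⟨hJ 0 (by simp), hJ _ (by simp)⟩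
  induction f using freeGroup_induction with
  | one => exact ⟨0, fun n t ht _ _ => by simpa using ht⟩
  | of h => exact ⟨1, gen h⟩
  | inv h _ =>
    refine ⟨1, fun n t ht hI hJ => (gen h n t ht hI hJ).congr fun w hw => ?_⟩
    simp only [map_mul, inv_inv, rho_of_inv hw]
  | mul f g hf hg =>
    obtain ⟨R₁, h1⟩ := hf
    obtain ⟨R₂, h2⟩ := hg
    obtain ⟨D, hD⟩ := exists_radius g⁻¹
    refine ⟨R₁ + R₂ + D, fun n t ht hI hJ => ?_⟩
    push_cast at hJ
    have := h1 n (g * t * g⁻¹) (h2 n t ht hI fun p hp => hJ p (by omega)) (by simp [hI])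
      (fun p hp => by
        have hd := (hD _ (disj_std (α := α) n .J) p).1
        rw [abs_le] at hd
        have e := hJ (rho (std α n .J) g⁻¹ p) (by omega)
        simp only [map_mul, Perm.mul_apply]
        rw [e]
        simp)
    simpa [mul_assoc] using this

section Normal

variable {M : Subgroup (FreeGroup Gen)}

theorem conj_mem_real (hnorm : ∀ g ∈ commutator (FreeGroup Gen), ∀ f ∈ M, g * f * g⁻¹ ∈ M) {n : ℕ}
    {σ τ : Perm ℤ} (hσ : σ ∈ real α n M) (hτ : τ ∈ real α n (commutator (FreeGroup Gen))) :
    τ * σ * τ⁻¹ ∈ real α n M := by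
  obtain ⟨f, hfM, hf, hfI, rfl⟩ := mem_real.mp hσ
  obtain ⟨g, hgM, hg, hgI, rfl⟩ := mem_real.mp hτ
  exact mem_real.mpr ⟨g * f * g⁻¹, hnorm g hgM f hfM, (hg.mul hf).mul hg.inv,
    by simp [hfI, hgI], by simp⟩

/-- One cycle of length three in a normal subgroup produces the whole alternating group. -/
theorem swapFull_of_three_cycle
    (hnorm : ∀ g ∈ commutator (FreeGroup Gen), ∀ f ∈ M, g * f * g⁻¹ ∈ M) {n : ℕ} (hn : 1 ≤ n)
    {a b c : ℤ} (ha : a ∈ Set.Icc 0 (len α n .J)) (hab : a ≠ b)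
    (hac : a ≠ c) (h : swap b c * swap a c ∈ real α n M) :
    SwapFull (real α n M) (Set.Icc 0 (len α n .J)) := by
  have hk := len_J_lt_succ (α := α) (n - 1) .J
  have hk' := le_len (α := α) (n - 1) .J
  rw [Nat.sub_add_cancel hn] at hk
  apply swapFull_of_fan (b := b) (c := c)
  intro e he heb hec
  rw [swap_comm c e]
  by_cases hea : e = a
  · rwa [hea]
  obtain ⟨d, hd, d', hd', hdS, hdS', hdd⟩ := exists_fresh_pair {a, b, c, e} (L := len α n .J) (by
    have := Finset.card_le_four (a := a) (b := b) (c := c) (d := e)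
    omega)
  simp only [Finset.mem_insert, Finset.mem_singleton, not_or] at hdS hdS'
  have := conj_mem_real hnorm h
    (swapFull_real_commutator hn a ha e he d hd d' hd' (Ne.symm hea) hdd)
  rw [conj_swap_mul_swap] at this
  have ta : (swap a e * swap d d') a = e := by
    rw [Perm.mul_apply, swap_apply_of_ne_of_ne (a := d) (by tauto) (by tauto), swap_apply_left]
  have tb : (swap a e * swap d d') b = b := by
    rw [Perm.mul_apply, swap_apply_of_ne_of_ne (a := d) (by tauto) (by tauto),
      swap_apply_of_ne_of_ne (Ne.symm hab) (Ne.symm heb)]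
  have tc : (swap a e * swap d d') c = c := by
    rw [Perm.mul_apply, swap_apply_of_ne_of_ne (a := d) (by tauto) (by tauto),
      swap_apply_of_ne_of_ne (Ne.symm hac) (Ne.symm hec)]
  rwa [ta, tb, tc] at this

/-- A subgroup normalized by the derived subgroup and acting non-trivially contains the local
alternating groups of all sufficiently big generations. An element `f` of the subgroup moves some
vertex of `J_m`, deep inside of the block. Then its commutator with a local cycle of length three
moving this vertex is a non-trivial local element, and the commutator of that element with another
local cycle is a cycle of length three. -/
theorem exists_swapFull (hnorm : ∀ g ∈ commutator (FreeGroup Gen), ∀ f ∈ M, g * f * g⁻¹ ∈ M)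
    {f : FreeGroup Gen} (hfM : f ∈ M) (hf : toG α f ≠ 1) :
    ∃ m₀, ∀ m, m₀ ≤ m → SwapFull (real α m M) (Set.Icc 0 (len α m .J)) := by
  rw [Ne, toG_eq_one_iff] at hf
  push Not at hf
  obtain ⟨w, hw, i, hi⟩ := hf
  obtain ⟨R₀, hR₀⟩ := exists_radius f
  obtain ⟨R₁, hR₁⟩ := exists_depth (α := α) f
  obtain ⟨m₁, hm₁⟩ := exists_window hw i (R₀ + R₁ + 5)
  refine ⟨max m₁ 10, fun m hm => ?_⟩
  obtain ⟨j, hj1, hj2, hj⟩ := hm₁ m (le_trans (le_max_left _ _) hm)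
  have hm10 : 10 ≤ m := le_trans (le_max_right _ _) hm
  have hL := le_len (α := α) m .J
  have hsh := rho_shift_eq (shift_disj hw) (disj_std m .J) hR₀
    (fun t ht => hj t (ht.trans (by push_cast; omega)))
  push_cast at hj1 hj2
  set L := len α m .J with hLdef
  set θ := rho (std α m .J) f with hθ
  have hjj : θ j ≠ j := by
    intro h
    rw [h, sub_self, sub_eq_zero] at hsh
    exact hi hsh
  have hmem : ∀ p ∈ Set.Icc 0 L, θ p ∈ Set.Icc 0 L := fun p hp => rho_std_mem m .J f hp
  have hC := swapFull_real_commutator (α := α) (show 1 ≤ m by omega)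
  -- two further vertices near `j`, different from its image
  obtain ⟨p, q, hp, hq, hpq, hpj, hqj⟩ : ∃ p q : ℤ, (j < p ∧ p ≤ j + 3) ∧ (j < q ∧ q ≤ j + 3) ∧
      p ≠ q ∧ p ≠ θ j ∧ q ≠ θ j := by
    by_cases h1 : θ j = j + 1
    · exact ⟨j + 2, j + 3, by omega, by omega, by omega, by omega, by omega⟩
    by_cases h2 : θ j = j + 2
    · exact ⟨j + 1, j + 3, by omega, by omega, by omega, by omega, by omega⟩
    · exact ⟨j + 1, j + 2, by omega, by omega, by omega, by omega, by omega⟩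
  have hjL : j ∈ Set.Icc 0 L := ⟨by omega, by omega⟩
  have hpL : p ∈ Set.Icc 0 L := ⟨by omega, by omega⟩
  have hqL : q ∈ Set.Icc 0 L := ⟨by omega, by omega⟩
  obtain ⟨t, htC, ht, htI, htJ⟩ := mem_real.mp (hC j hjL p hpL p hpL q hqL (by omega) hpq)
  have hν : swap (θ j) (θ p) * swap (θ p) (θ q) * (swap p q * swap j p) ∈ real α m M := by
    refine mem_real.mpr ⟨f * t * f⁻¹ * t⁻¹, ?_, (hR₁ m t ht htI ?_).mul ht.inv, ?_, ?_⟩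
    · have := M.mul_mem hfM (hnorm t htC _ (M.inv_mem hfM))
      simpa [mul_assoc] using this
    · intro r hr
      rw [htJ, Perm.mul_apply, swap_apply_of_ne_of_ne (a := p) (by omega) (by omega),
        swap_apply_of_ne_of_ne (by omega) (by omega)]
    · simp [htI]
    · simp only [map_mul, map_inv, htJ]
      rw [conj_swap_mul_swap, mul_inv_rev, swap_inv, swap_inv]
  set ν := swap (θ j) (θ p) * swap (θ p) (θ q) * (swap p q * swap j p) with hνdef
  have hθjp : θ j ≠ θ p := θ.injective.ne (by omega)
  have hθjq : θ j ≠ θ q := θ.injective.ne (by omega)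
  have hνa : ν (θ j) = θ p := by
    simp only [hνdef, Perm.mul_apply]
    rw [swap_apply_of_ne_of_ne hjj hpj.symm, swap_apply_of_ne_of_ne hpj.symm hqj.symm,
      swap_apply_of_ne_of_ne hθjp hθjq, swap_apply_left]
  have hcard : (({j, p, q, θ j, θ p, θ q} : Finset ℤ).card : ℤ) ≤ 6 := by
    exact_mod_cast Finset.card_le_six
  obtain ⟨c, hc, d, hd, hcS, hdS, hcd⟩ := exists_fresh_pair {j, p, q, θ j, θ p, θ q} (L := L)
    (by omega)
  simp only [Finset.mem_insert, Finset.mem_singleton, not_or] at hcS hdS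
  have hfix : ∀ r, (r ≠ j ∧ r ≠ p ∧ r ≠ q ∧ r ≠ θ j ∧ r ≠ θ p ∧ r ≠ θ q) → ν r = r := by
    rintro r ⟨h1, h2, h3, h4, h5, h6⟩
    simp only [hνdef, Perm.mul_apply]
    rw [swap_apply_of_ne_of_ne h1 h2, swap_apply_of_ne_of_ne h2 h3, swap_apply_of_ne_of_ne h5 h6,
      swap_apply_of_ne_of_ne h4 h5]
  have hτ := hC (θ j) (hmem j hjL) c hc c hc d hd (Ne.symm hcS.2.2.2.1) hcd
  have h3 : swap (θ p) c * swap (θ j) c ∈ real α m M := by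
    have h := Subgroup.mul_mem _ hν (conj_mem_real hnorm (Subgroup.inv_mem _ hν) hτ)
    have e : ν * (swap (θ j) c * swap c d * ν⁻¹ * (swap (θ j) c * swap c d)⁻¹) =
        ν * (swap (θ j) c * swap c d) * ν⁻¹ * (swap (θ j) c * swap c d)⁻¹ := by group
    rw [e, conj_swap_mul_swap, hνa, hfix c hcS, hfix d hdS, mul_inv_rev, swap_inv, swap_inv,
      mul_assoc, swap_mul_self_mul] at h
    exact h
  exact swapFull_of_three_cycle hnorm (by omega) (hmem j hjL) hθjp (Ne.symm hcS.2.2.2.1) h3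

/-- In particular, such a subgroup contains the generators `a_i`. -/
theorem of_mem_of_normal (hker : ∀ f, toG α f = 1 → f ∈ M)
    (hnorm : ∀ g ∈ commutator (FreeGroup Gen), ∀ f ∈ M, g * f * g⁻¹ ∈ M)
    {f : FreeGroup Gen} (hfM : f ∈ M) (hf : toG α f ≠ 1) {a : Gen} (ha : a ∈ aSet) :
    FreeGroup.of a ∈ M := by
  obtain ⟨m₀, hm₀⟩ := exists_swapFull hnorm hfM hf
  exact (local_of_mem_aSet 0 ha).mem_of_swapFull hker hm₀

end Normal

theorem toG_of_mem_commutator {a : Gen} (ha : a ∈ aSet) :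
    toG α (FreeGroup.of a) ∈ commutator (G α) := by
  have hmap : (commutator (FreeGroup Gen)).map (toG α) ≤ commutator (G α) := by
    rw [commutator_def, Subgroup.map_commutator]
    exact Subgroup.commutator_mono le_top le_top
  have : FreeGroup.of a ∈ (commutator (G α)).comap (toG α) := by
    refine (local_of_mem_aSet 0 ha).mem_of_swapFull (α := α) (m₀ := 1)
      (fun f hf => by simp [Subgroup.mem_comap, hf]) fun m hm => ?_
    refine altPerm_le.mp ((altPerm_le.mpr (swapFull_real_commutator hm)).trans ?_)
    exact Subgroup.map_mono (inf_le_inf_right _ (inf_le_inf_right _ (Subgroup.map_le_iff_le_comap.mp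
      hmap)))
  exact this

/-! ### Relations between the connecting generators -/

/-- Of two consecutive edges at most one is a connector. -/
theorem blk_chain (n : ℕ) (B : Block) :
    (blk α n B).IsChain (fun A A' => A ⊆ aSet ∨ A' ⊆ aSet) := by
  have key : ∀ l m : List (Finset Gen), ∀ A : Finset Gen,
      (l.IsChain (fun A A' => A ⊆ aSet ∨ A' ⊆ aSet) ∧ (∀ A ∈ l.head?, A ⊆ aSet) ∧ l ≠ [] ∧
        ∀ A ∈ l.getLast?, A ⊆ aSet) →
      (m.IsChain (fun A A' => A ⊆ aSet ∨ A' ⊆ aSet) ∧ (∀ A ∈ m.head?, A ⊆ aSet) ∧ m ≠ [] ∧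
        ∀ A ∈ m.getLast?, A ⊆ aSet) → IsConn A →
      ((l ++ [A] ++ m).IsChain (fun A A' => A ⊆ aSet ∨ A' ⊆ aSet) ∧
        (∀ B ∈ (l ++ [A] ++ m).head?, B ⊆ aSet) ∧ l ++ [A] ++ m ≠ [] ∧
        ∀ B ∈ (l ++ [A] ++ m).getLast?, B ⊆ aSet) := by
    rintro l m A ⟨h1, h2, h3, h4⟩ ⟨k1, k2, k3, k4⟩ -
    refine ⟨?_, ?_, by simp, ?_⟩
    · rw [List.append_assoc, List.isChain_append, List.isChain_append]
      refine ⟨h1, ⟨by simp, k1, fun _ _ B hB => Or.inr (k2 B hB)⟩, fun B hB _ _ => Or.inl (h4 B hB)⟩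
    · intro B hB
      rw [List.append_assoc, List.head?_append_of_ne_nil _ h3] at hB
      exact h2 B hB
    · intro B hB
      rw [List.getLast?_append_of_ne_nil _ k3] at hB
      exact k4 B hB
  refine (blk_induction (n₀ := 0) (P := fun l =>
    l.IsChain (fun A A' => A ⊆ aSet ∨ A' ⊆ aSet) ∧ (∀ A ∈ l.head?, A ⊆ aSet) ∧ l ≠ [] ∧
        ∀ A ∈ l.getLast?, A ⊆ aSet) ?_ ?_ key n (Nat.zero_le n) B).1
  · rintro (_ | _) <;> simp [blk, IJ, aSet]
  · rintro l ⟨h1, h2, h3, h4⟩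
    refine ⟨?_, by simpa using h4, by simpa using h3, by simpa using h2⟩
    rw [List.isChain_reverse]
    exact h1.imp fun _ _ h => h.symm

theorem blk_mem (n : ℕ) (B : Block) : ∀ A ∈ blk α n B, A ⊆ aSet ∨ IsConn A := by
  refine blk_induction (n₀ := 0) (P := fun l => ∀ A ∈ l, A ⊆ aSet ∨ IsConn A) ?_ ?_ ?_ n
    (Nat.zero_le n) B
  · rintro (_ | _) <;> simp [blk, IJ, aSet]
  · intro l h A hA
    exact h A (by simpa using hA)
  · intro l m A h1 h2 hA B hB
    simp only [List.mem_append, List.mem_singleton] at hB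
    rcases hB with (hB | rfl) | hB
    · exact h1 B hB
    · exact Or.inr hA
    · exact h2 B hB

theorem shift_edges {w : ℤ → Finset Gen} (hw : w ∈ shift α) (i : ℤ) :
    (w i ⊆ aSet ∨ IsConn (w i)) ∧ (w i ⊆ aSet ∨ w (i + 1) ⊆ aSet) := by
  obtain ⟨u, ⟨n, hu⟩, hinf⟩ := hw i 2
  obtain ⟨B, rfl⟩ : ∃ B, u = blk α n B := by
    rcases hu with h | h
    · exact ⟨.I, h⟩
    · exact ⟨.J, h⟩
  have hs : subword w i 2 = [w i, w (i + 1)] := by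
    simp [subword, List.range_succ]
  rw [hs] at hinf
  refine ⟨blk_mem n B _ (hinf.subset (by simp)), ?_⟩
  simpa using (blk_chain n B).infix hinf

theorem step_comm {w : ℤ → Finset Gen} (hw : w ∈ shift α) {g h : Gen} (hg : g ∉ aSet)
    (hh : h ∉ aSet) (i : ℤ) : step w g (step w h i) = step w h (step w g i) := by
  have hd := shift_disj hw
  have hn : ∀ {j : ℤ}, w j ⊆ aSet → g ∉ w j ∧ h ∉ w j := fun hj =>
    ⟨fun h' => hg (hj h'), fun h' => hh (hj h')⟩
  have e1 := (shift_edges hw i).2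
  have e2 := (shift_edges hw (i - 1)).2
  have e3 := (shift_edges hw (i - 1 - 1)).2
  rw [sub_add_cancel] at e2 e3
  -- if the edge `i` is a connector, then its neighbors are not, and only it can be crossed
  by_cases h0 : w i ⊆ aSet
  · obtain ⟨g0, h0'⟩ := hn h0
    by_cases h1 : w (i - 1) ⊆ aSet
    · obtain ⟨g1, h1'⟩ := hn h1
      rw [step_of_notMem h0' h1', step_of_notMem g0 g1, step_of_notMem h0' h1']
    · obtain ⟨g2, h2'⟩ := hn (e3.resolve_right h1)
      by_cases gm : g ∈ w (i - 1) <;> by_cases hm : h ∈ w (i - 1)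
      · rw [step_of_mem_pred hd hm, step_of_mem gm, step_of_mem_pred hd gm, step_of_mem hm]
      · rw [step_of_notMem h0' hm, step_of_mem_pred hd gm, step_of_notMem hm h2']
      · rw [step_of_notMem g0 gm, step_of_mem_pred hd hm, step_of_notMem gm g2]
      · rw [step_of_notMem h0' hm, step_of_notMem g0 gm, step_of_notMem h0' hm]
  · obtain ⟨g1, h1'⟩ := hn (e2.resolve_right h0)
    obtain ⟨g2, h2'⟩ := hn (e1.resolve_left h0)
    have key : ∀ k : Gen, k ∈ w i → step w k (i + 1) = i := by
      intro k hk
      rw [step_of_mem_pred hd (by simpa using hk)]; ring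
    by_cases gm : g ∈ w i <;> by_cases hm : h ∈ w i
    · rw [step_of_mem hm, key g gm, step_of_mem gm, key h hm]
    · rw [step_of_notMem hm h1', step_of_mem gm, step_of_notMem h2' (by simpa using hm)]
    · rw [step_of_notMem gm g1, step_of_mem hm, step_of_notMem g2 (by simpa using gm)]
    · rw [step_of_notMem hm h1', step_of_notMem gm g1, step_of_notMem hm h1']

theorem toG_of_comm {g h : Gen} (hg : g ∉ aSet) (hh : h ∉ aSet) :
    toG α (FreeGroup.of g * FreeGroup.of h) = toG α (FreeGroup.of h * FreeGroup.of g) := by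
  apply Subtype.ext
  ext1 ⟨w, i⟩
  have hd := shift_disj w.2
  rw [toG_apply, toG_apply]
  simp only [map_mul, Perm.mul_apply, rho_of hd, step_comm w.2 hg hh]

theorem toG_of_mul_self (h : Gen) : toG α (FreeGroup.of h * FreeGroup.of h) = 1 := by
  rw [toG_eq_one_iff]
  intro w hw i
  simp only [map_mul, Perm.mul_apply, rho_of (shift_disj hw), (shift_disj hw).step_involutive h i]

theorem toG_bcd : toG α (FreeGroup.of .b * FreeGroup.of .c * FreeGroup.of .d) = 1 := by
  rw [toG_eq_one_iff]
  intro w hw i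
  have hd := shift_disj hw
  simp only [map_mul, Perm.mul_apply, rho_of hd]
  -- each edge is labeled by none or by exactly two of the letters `b`, `c`, `d`
  have key : ∀ j, (.b ∉ w j ∧ .c ∉ w j ∧ .d ∉ w j) ∨ (.b ∈ w j ∧ .c ∈ w j ∧ .d ∉ w j) ∨
      (.b ∈ w j ∧ .c ∉ w j ∧ .d ∈ w j) ∨ (.b ∉ w j ∧ .c ∈ w j ∧ .d ∈ w j) := by
    intro j
    rcases (shift_edges hw j).1 with h | h
    · exact Or.inl ⟨fun h' => absurd (h h') (by decide), fun h' => absurd (h h') (by decide),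
        fun h' => absurd (h h') (by decide)⟩
    · rcases h with h | h | h | h | h <;> rw [h] <;> decide
  by_cases h0 : (.b ∉ w i ∧ .c ∉ w i ∧ .d ∉ w i)
  · by_cases h1 : (.b ∉ w (i - 1) ∧ .c ∉ w (i - 1) ∧ .d ∉ w (i - 1))
    · rw [step_of_notMem h0.2.2 h1.2.2, step_of_notMem h0.2.1 h1.2.1, step_of_notMem h0.1 h1.1]
    · have he : w (i - 1 - 1) ⊆ aSet := by
        have := (shift_edges hw (i - 1 - 1)).2
        rw [sub_add_cancel] at this
        refine this.resolve_right fun h => h1 ⟨fun h' => absurd (h h') (by decide),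
          fun h' => absurd (h h') (by decide), fun h' => absurd (h h') (by decide)⟩
      have he' : ∀ {k : Gen}, k ∉ aSet → k ∉ w (i - 1 - 1) := fun hk h => hk (he h)
      rcases (key (i - 1)).resolve_left h1 with h | h | h
      · rw [step_of_notMem h0.2.2 h.2.2, step_of_mem_pred hd h.2.1, step_of_mem h.1,
          sub_add_cancel]
      · rw [step_of_mem_pred hd h.2.2, step_of_notMem h.2.1 (he' (by decide)), step_of_mem h.1,
          sub_add_cancel]
      · rw [step_of_mem_pred hd h.2.2, step_of_mem h.2.1, sub_add_cancel,
          step_of_notMem h0.1 h.1]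
  · have he : w (i + 1) ⊆ aSet := by
      refine (shift_edges hw i).2.resolve_left fun h => h0 ⟨fun h' => absurd (h h') (by decide),
          fun h' => absurd (h h') (by decide), fun h' => absurd (h h') (by decide)⟩
    have he1 : w (i - 1) ⊆ aSet := by
      have := (shift_edges hw (i - 1)).2
      rw [sub_add_cancel] at this
      refine this.resolve_right fun h => h0 ⟨fun h' => absurd (h h') (by decide),
          fun h' => absurd (h h') (by decide), fun h' => absurd (h h') (by decide)⟩
    have he' : ∀ {k : Gen}, k ∉ aSet → k ∉ w (i + 1) := fun hk h => hk (he h)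
    have he1' : ∀ {k : Gen}, k ∉ aSet → k ∉ w (i - 1) := fun hk h => hk (he1 h)
    have back : ∀ {k : Gen}, k ∈ w i → step w k (i + 1) = i := fun {k} hk => by
      rw [step_of_mem_pred hd (by simpa using hk)]; ring
    rcases (key i).resolve_left h0 with h | h | h
    · rw [step_of_notMem h.2.2 (he1' (by decide)), step_of_mem h.2.1, back h.1]
    · rw [step_of_mem h.2.2, step_of_notMem (he' (by decide)) (by simpa using h.2.1), back h.1]
    · rw [step_of_mem h.2.2, back h.2.1, step_of_notMem h.1 (he1' (by decide))]

/-- The derived subgroup is contained in every subgroup which is normalized by it and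
acts non-trivially. Indeed, the normal core of such a subgroup contains all the generators `a_i`,
and the other generators commute. -/
theorem commutator_le_of_normal {M : Subgroup (FreeGroup Gen)} (hker : ∀ f, toG α f = 1 → f ∈ M)
    (hnorm : ∀ g ∈ commutator (FreeGroup Gen), ∀ f ∈ M, g * f * g⁻¹ ∈ M)
    {f : FreeGroup Gen} (hfM : f ∈ M) (hf : toG α f ≠ 1) : commutator (FreeGroup Gen) ≤ M := by
  have ha : ∀ a ∈ aSet, FreeGroup.of a ∈ M.normalCore := by
    intro a ha u
    have : FreeGroup.of a ∈ M.comap (MulAut.conj u).toMonoidHom := by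
      refine of_mem_of_normal (α := α) (M := M.comap (MulAut.conj u).toMonoidHom)
        (f := u⁻¹ * f * u) (fun v hv => hker _ ?_) (fun g hg v hv => ?_) ?_ ?_ ha
      · simp [hv]
      · have := hnorm (u * g * u⁻¹) ((inferInstance : (commutator (FreeGroup Gen)).Normal).conj_mem
          g hg u) _ hv
        simp only [Subgroup.mem_comap, MulEquiv.coe_toMonoidHom, MulAut.conj_apply] at this ⊢
        convert this using 1
        group
      · simp only [Subgroup.mem_comap, MulEquiv.coe_toMonoidHom, MulAut.conj_apply]
        convert hfM using 1
        group
      · intro h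
        apply hf
        simp only [map_mul, map_inv] at h
        rw [mul_assoc, inv_mul_eq_one, eq_comm, mul_eq_right] at h
        exact h
    simpa using this
  refine le_trans ?_ M.normalCore_le
  have hker' : ∀ v, toG α v = 1 → v ∈ M.normalCore := by
    intro v hv u
    exact hker _ (by simp [hv])
  set q := QuotientGroup.mk' M.normalCore
  have hq : ∀ v, q v = 1 ↔ v ∈ M.normalCore := fun v => QuotientGroup.eq_one_iff v
  have gens : ∀ g h : Gen, Commute (q (FreeGroup.of g)) (q (FreeGroup.of h)) := by
    intro g h
    by_cases hg : g ∈ aSet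
    · rw [(hq _).mpr (ha g hg)]; exact Commute.one_left _
    by_cases hh : h ∈ aSet
    · rw [(hq _).mpr (ha h hh)]; exact Commute.one_right _
    · have : q ((FreeGroup.of g * FreeGroup.of h) * (FreeGroup.of h * FreeGroup.of g)⁻¹) = 1 := by
        rw [hq]
        apply hker'
        rw [map_mul, map_inv, toG_of_comm hg hh, mul_inv_cancel]
      rw [map_mul, map_inv, mul_inv_eq_one] at this
      simp only [map_mul] at this
      exact this
  have all : ∀ u v : FreeGroup Gen, Commute (q u) (q v) := by
    have h1 : ∀ (g : Gen) (v : FreeGroup Gen), Commute (q (FreeGroup.of g)) (q v) := by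
      intro g v
      induction v using freeGroup_induction with
      | one => simp
      | of h => exact gens g h
      | inv h ih => rw [map_inv]; exact ih.inv_right
      | mul a b ha hb => rw [map_mul]; exact ha.mul_right hb
    intro u v
    induction u using freeGroup_induction with
    | one => simp
    | of h => exact h1 h v
    | inv h ih => rw [map_inv]; exact ih.inv_left
    | mul a b ha hb => rw [map_mul]; exact ha.mul_left hb
  rw [commutator_def, Subgroup.commutator_le]
  intro u _ v _
  rw [← hq, map_commutatorElement, commutatorElement_eq_one_iff_mul_comm]
  exact all u v

/-! ### Symmetric sequences in the subshift -/

theorem blk_J_prefix (n : ℕ) (B : Block) : blk α n .J <+: blk α (n + 1) B := by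
  cases B
  · rw [blk_I_succ, List.append_assoc]
    exact List.prefix_append _ _
  · rw [blk_J_succ, List.append_assoc, List.append_assoc]
    exact List.prefix_append _ _

theorem blk_J_suffix (n : ℕ) (B : Block) : (blk α n .J).reverse <:+ blk α (n + 1) B := by
  cases B
  · rw [blk_I_succ]
    exact List.suffix_append _ _
  · rw [blk_J_succ]
    exact List.suffix_append _ _

theorem std_J_eq {n m : ℕ} (hnm : n ≤ m) {p : ℤ} (h0 : 0 ≤ p) (hp : p < len α n .J) :
    std α m .J p = std α n .J p := by
  have h : blk α n .J <+: blk α m .J := by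
    induction m, hnm using Nat.le_induction with
    | base => exact List.prefix_rfl
    | succ m _ ih => exact ih.trans (blk_J_prefix m .J)
  obtain ⟨t, ht⟩ := h
  have hr := reads_std (α := α) m .J
  rw [← ht, reads_append] at hr
  exact hr.1.eq_ofList h0 hp

/-- The sequence consisting of a connector `A` on the edge `0` and of two infinite rays, each
of them the limit of the words `J_n` read from this edge. -/
def symSeq (α : ℕ → Symb) (A : Finset Gen) (n : ℤ) : Finset Gen :=
  if n = 0 then A else std α n.natAbs .J (n.natAbs - 1)

theorem symSeq_zero (A : Finset Gen) : symSeq α A 0 = A := by simp [symSeq]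

theorem symSeq_neg (A : Finset Gen) (n : ℤ) : symSeq α A (-n) = symSeq α A n := by
  simp [symSeq]

theorem symSeq_eq_std (A : Finset Gen) (m : ℕ) {p : ℤ} (h0 : 0 ≤ p) (hp : p < len α m .J) :
    symSeq α A (p + 1) = std α m .J p := by
  have h1 := le_len (α := α) (p + 1).natAbs .J
  have e : ((p + 1).natAbs : ℤ) = p + 1 := Int.natAbs_of_nonneg (by omega)
  rw [symSeq, if_neg (by omega), e, add_sub_cancel_right]
  rw [e] at h1
  rcases le_total (p + 1).natAbs m with h | h
  · exact (std_J_eq h h0 (by omega)).symm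
  · exact std_J_eq h h0 hp

theorem subword_infix {w : ℤ → Finset Gen} {p i : ℤ} {k : ℕ} {u : List (Finset Gen)}
    (h : Reads w p u) (h1 : p ≤ i) (h2 : i + k ≤ p + u.length) : subword w i k <:+: u := by
  obtain ⟨a, ha⟩ := Int.eq_ofNat_of_zero_le (show 0 ≤ i - p by omega)
  have e : subword w i k = (u.drop a).take k := by
    rw [subword_eq]
    apply List.ext_getElem
    · simp only [List.length_map, List.length_range, List.length_take, List.length_drop]
      omega
    · intro j h3 h4
      simp only [List.length_map, List.length_range] at h3
      have := reads_iff.mp h (a + j) (by omega)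
      rw [List.getD_eq_getElem _ _ (by omega)] at this
      simp only [List.getElem_map, List.getElem_range, List.getElem_take, List.getElem_drop]
      rw [← this]
      congr 1
      push_cast
      omega
  rw [e]
  exact (List.take_prefix _ _).isInfix.trans (List.drop_suffix _ _).isInfix

theorem symSeq_reads (A : Finset Gen) (m : ℕ) :
    Reads (symSeq α A) (-len α m .J) ((blk α m .J).reverse ++ [A] ++ blk α m .J) := by
  have hlen : ((blk α m .J).length : ℤ) = len α m .J := rfl
  rw [reads_append, reads_append, reads_singleton]
  refine ⟨⟨?_, ?_⟩, ?_⟩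
  · have : Reads (view (symSeq α A) 0 true) 0 (blk α m .J) := by
      rw [reads_iff]
      intro i hi
      rw [← ofList_natCast]
      simp only [view, if_true, zero_add]
      rw [show (0 : ℤ) - i - 1 = -(i + 1) by ring, symSeq_neg]
      exact symSeq_eq_std A m (by omega) (by omega)
    rw [reads_view_reverse] at this
    rwa [zero_sub] at this
  · rw [List.length_reverse, hlen, neg_add_cancel, symSeq_zero]
  · rw [reads_iff]
    intro i hi
    rw [← ofList_natCast]
    rw [show -len α m .J + (((blk α m .J).reverse ++ [A]).length : ℤ) + i = i + 1 by
      simp only [List.length_append, List.length_reverse, List.length_cons, List.length_nil]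
      push_cast
      rw [hlen]
      ring]
    exact symSeq_eq_std A m (by omega) (by omega)

theorem symSeq_mem {A : Finset Gen}
    (h : ∀ N : ℕ, ∃ m, N ≤ m ∧ ∃ n B, (blk α m .J).reverse ++ [A] ++ blk α m .J <:+: blk α n B) :
    symSeq α A ∈ shift α := by
  intro i k
  obtain ⟨m, hm, n, B, hB⟩ := h (i.natAbs + k)
  have hlen : ((blk α m .J).length : ℤ) = len α m .J := rfl
  have hL := le_len (α := α) m .J
  refine ⟨blk α n B, ⟨n, by cases B <;> simp [blk]⟩,
    (subword_infix (symSeq_reads A m) ?_ ?_).trans hB⟩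
  · omega
  · simp only [List.length_append, List.length_reverse, List.length_cons, List.length_nil]
    push_cast
    omega

theorem infix_of_suffix_of_prefix {A : Type*} {l l' r r' : List A} {a : A} (hl : l' <:+ l)
    (hr : r' <+: r) : l' ++ [a] ++ r' <:+: l ++ [a] ++ r := by
  obtain ⟨s, rfl⟩ := hl
  obtain ⟨t, rfl⟩ := hr
  exact ⟨s, t, by simp⟩

theorem blk_J_prefix_reverse (n : ℕ) (B : Block) :
    blk α n .J <+: (blk α (n + 1) B).reverse := by
  have := List.reverse_prefix.mpr (blk_J_suffix (α := α) n B)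
  rwa [List.reverse_reverse] at this

theorem symSeq_conn_mem {A : Finset Gen} {i : ℕ} (h : ∀ k, conn (3 * k + i) = A) :
    symSeq α A ∈ shift α := by
  refine symSeq_mem fun N => ⟨3 * N + i + 2, by omega, 3 * (N + 1) + i + 1, .I, ?_⟩
  obtain ⟨m, hm⟩ : ∃ m, 3 * (N + 1) + i = m + 1 := ⟨3 * N + i + 2, by omega⟩
  rw [blk_I_succ, h, hm, show 3 * N + i + 2 = m by omega]
  exact infix_of_suffix_of_prefix (blk_J_suffix _ _) (blk_J_prefix_reverse _ _)

theorem prefix_tail (n : ℕ) (t : List (Finset Gen)) : blk α n .J <+: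
    t.flatMap (fun A => blk α (n + 1) .I ++ [A]) ++ (blk α (n + 1) .J).reverse := by
  cases t with
  | nil => exact blk_J_prefix_reverse n .J
  | cons A t =>
    rw [List.flatMap_cons, List.append_assoc, List.append_assoc]
    exact (blk_J_prefix n .I).trans (List.prefix_append _ _)

theorem Symb.Uses.mem {s : Symb} {z : Letter} (h : s.Uses z) :
    s.head = {z.toGen} ∨ {z.toGen} ∈ s.tail := by
  cases s with
  | sigma =>
    cases z
    · exact Or.inl rfl
    · exact Or.inr (by simp [Symb.tail, Letter.toGen])
  | word t ht => exact Or.inr (List.mem_map.mpr ⟨z, h, rfl⟩)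

theorem symSeq_letter_mem {z : Letter} (h : ∀ N : ℕ, ∃ n, N ≤ n ∧ (α n).Uses z) :
    symSeq α {z.toGen} ∈ shift α := by
  refine symSeq_mem fun N => ?_
  obtain ⟨n, hn, hz⟩ := h (N + 1)
  obtain ⟨m, rfl⟩ : ∃ m, n = m + 1 := ⟨n - 1, by omega⟩
  refine ⟨m, by omega, m + 1 + 1, .J, ?_⟩
  rw [blk_J_succ]
  rcases hz.mem with h1 | h1
  · rw [h1, List.append_assoc _ (List.flatMap _ _)]
    exact infix_of_suffix_of_prefix (blk_J_suffix _ _) (prefix_tail _ _)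
  · obtain ⟨t₁, t₂, ht⟩ := List.append_of_mem h1
    rw [ht, List.flatMap_append, List.flatMap_cons]
    have := infix_of_suffix_of_prefix (a := ({z.toGen} : Finset Gen))
      ((blk_J_suffix (α := α) m .I).trans (List.suffix_append
        (blk α (m + 1) .J ++ [(α (m + 1)).head] ++
          t₁.flatMap (fun A => blk α (m + 1) .I ++ [A])) _)) (prefix_tail (α := α) m t₂)
    convert this using 1
    simp

/-! ### Counting crossings of the axis of symmetry -/

section Cross

variable {w : ℤ → Finset Gen}

/-- One half of a symmetric sequence. -/
def ray (w : ℤ → Finset Gen) (n : ℤ) : Finset Gen := if 1 ≤ n then w n else ∅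

theorem disj_ray (hw : Disj w) : Disj (ray w) := by
  intro n
  unfold ray
  split_ifs
  · exact hw n
  · simp
  · simp
  · simp

theorem rho_one_sub (hw : Disj w) (hs : ∀ n, w (-n) = w n) (f : FreeGroup Gen) (n : ℤ) :
    rho w f (1 - n) = 1 - rho w f n := by
  have e : view w 1 true = w := by
    funext p
    simp only [view, if_true]
    rw [show (1 : ℤ) - p - 1 = -p by ring, hs]
  have := rho_view hw 1 true f n
  rw [e] at this
  simpa [vert] using this.symm

theorem max_step (hw : Disj w) {h : Gen} {n : ℤ} (hn : 1 ≤ n) :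
    max (step w h n) (1 - step w h n) = step (ray w) h n := by
  rcases hn.eq_or_lt with rfl | hn
  · by_cases h1 : h ∈ w 1
    · rw [step_of_mem h1, step_of_mem (by simpa [ray] using h1)]; rfl
    · rw [step_of_notMem (w := ray w) (by simpa [ray] using h1) (by simp [ray])]
      by_cases h2 : h ∈ w 0
      · rw [step_of_mem_pred hw (by simpa using h2)]; rfl
      · rw [step_of_notMem h1 (by simpa using h2)]; rfl
  · have e : step (ray w) h n = step w h n :=
      step_congr (by simp [ray, hn.le]) (by simp only [ray]; rw [if_pos (by omega)])
    have := step_sub_le w h n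
    rw [abs_le] at this
    rw [e]
    exact max_eq_left (by omega)

/-- The action on a symmetric sequence induces the action on its half, when it is folded along the
axis of symmetry. -/
theorem max_rho (hw : Disj w) (hs : ∀ n, w (-n) = w n) (f : FreeGroup Gen) : ∀ n : ℤ,
    max (rho w f n) (1 - rho w f n) = rho (ray w) f (max n (1 - n)) := by
  have hr := disj_ray hw
  induction f using freeGroup_induction with
  | one => simp
  | of h =>
    intro n
    rcases le_total 1 n with hn | hn
    · rw [max_eq_left (by omega : 1 - n ≤ n), rho_of hw, rho_of hr, max_step hw hn]
    · rcases hn.eq_or_lt with rfl | hn'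
      · rw [max_eq_left (by omega : (1 : ℤ) - 1 ≤ 1), rho_of hw, rho_of hr, max_step hw le_rfl]
      · rw [max_eq_right (by omega : n ≤ 1 - n), rho_of hr, ← max_step hw (by omega), ← rho_of hw,
          rho_one_sub hw hs, sub_sub_cancel, max_comm]
  | inv h ih => rw [rho_of_inv hw, rho_of_inv hr]; exact ih
  | mul f g hf hg => intro n; simp only [map_mul, Perm.mul_apply]; rw [hf, hg]

/-- The indicator of the set of vertices moved from the positive half of the line to the
other half. -/
noncomputable def cross (w : ℤ → Finset Gen) (f : FreeGroup Gen) (n : ℤ) : ZMod 2 :=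
  if 1 ≤ n ∧ rho w f n ≤ 0 then 1 else 0

theorem cross_support_finite (hw : Disj w) (f : FreeGroup Gen) :
    (Function.support (cross w f)).Finite := by
  obtain ⟨R, hR⟩ := exists_radius f
  refine (Set.finite_Icc (1 : ℤ) R).subset fun n hn => ?_
  have h : 1 ≤ n ∧ rho w f n ≤ 0 := by
    by_contra h
    exact hn (if_neg h)
  have := (hR w hw n).1
  rw [abs_le] at this
  exact ⟨h.1, by omega⟩

theorem cross_mul (hw : Disj w) (hs : ∀ n, w (-n) = w n) (f g : FreeGroup Gen) (n : ℤ) :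
    cross w (f * g) n = cross w g n + cross w f (rho (ray w) g n) := by
  by_cases hn : 1 ≤ n
  · have e := max_rho hw hs g n
    rw [max_eq_left (by omega : 1 - n ≤ n)] at e
    rw [← e]
    simp only [cross, map_mul, Perm.mul_apply, hn, true_and]
    set q := rho w g n
    by_cases hq : q ≤ 0
    · rw [max_eq_right (by omega), rho_one_sub hw hs]
      by_cases h : rho w f q ≤ 0
      · rw [if_pos h, if_pos hq, if_neg (by omega), add_zero]
      · rw [if_neg h, if_pos hq, if_pos (by omega)]
        rfl
    · rw [max_eq_left (by omega), if_neg hq, zero_add]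
      have : 1 ≤ q := by omega
      simp [this]
  · have e : rho (ray w) g n = n :=
      rho_eq_self_of_empty (disj_ray hw) (by simp [ray, hn])
        (by simp only [ray]; rw [if_neg (by omega)]) g
    rw [e]
    simp [cross, hn]

/-- The parity of the number of vertices moved across the axis of a symmetric sequence. -/
noncomputable def crossHom (hw : Disj w) (hs : ∀ n, w (-n) = w n) :
    FreeGroup Gen →* Multiplicative (ZMod 2) where
  toFun f := Multiplicative.ofAdd (∑ᶠ n, cross w f n)
  map_one' := by
    have : ∀ n, cross w 1 n = 0 := fun n => by
      simp only [cross, map_one, Perm.one_apply]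
      exact if_neg (by omega)
    simp [this]
  map_mul' f g := by
    rw [mul_comm (Multiplicative.ofAdd _), ← ofAdd_add]
    congr 1
    simp only [cross_mul hw hs]
    have hfin : (Function.support fun n => cross w f (rho (ray w) g n)).Finite :=
      (cross_support_finite hw f).preimage (rho (ray w) g).injective.injOn
    rw [finsum_add_distrib (cross_support_finite hw g) hfin]
    congr 1
    exact finsum_comp_equiv (rho (ray w) g) (f := cross w f)

end Cross

/-- The parity of the number of the letters belonging to `A`. -/
def count (A : Finset Gen) : FreeGroup Gen →* Multiplicative (ZMod 2) :=
  FreeGroup.lift fun h => Multiplicative.ofAdd (if h ∈ A then 1 else 0)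

theorem count_of (A : Finset Gen) (h : Gen) :
    count A (FreeGroup.of h) = Multiplicative.ofAdd (if h ∈ A then 1 else 0) := by
  simp [count]

/-- If `A` is the axis of a symmetric sequence in the subshift, then the parity of the number of the
letters belonging to `A` is well defined on the group. -/
theorem count_eq_one {A : Finset Gen} (hA : symSeq α A ∈ shift α) {f : FreeGroup Gen}
    (hf : toG α f = 1) : count A f = 1 := by
  have hw := shift_disj hA
  have e : count A = crossHom hw (symSeq_neg A) := by
    ext h : 1
    rw [count_of]
    change _ = Multiplicative.ofAdd (∑ᶠ n, cross (symSeq α A) (FreeGroup.of h) n)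
    congr 1
    rw [finsum_eq_single _ 1]
    · simp only [cross, rho_of hw, le_refl, true_and]
      congr 1
      by_cases h0 : h ∈ symSeq α A 0
      · rw [step_of_mem_pred hw (by simpa using h0)]
        simpa [symSeq_zero] using h0
      · have h0' := h0
        rw [symSeq_zero] at h0'
        simp only [h0', eq_iff_iff, false_iff, not_le]
        by_cases h1 : h ∈ symSeq α A 1
        · rw [step_of_mem h1]; omega
        · rw [step_of_notMem h1 (by simpa using h0)]; omega
    · intro n hn
      refine if_neg fun ⟨h1, h2⟩ => ?_
      rw [rho_of hw] at h2
      have := step_sub_le (symSeq α A) h n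
      rw [abs_le] at this
      omega
  rw [e]
  change Multiplicative.ofAdd (∑ᶠ n, cross (symSeq α A) f n) = 1
  have : ∀ n, cross (symSeq α A) f n = 0 := fun n => by
    rw [cross, toG_eq_one_iff.mp hf _ hA]
    exact if_neg (by omega)
  simp [this]

/-! ### The abelianization -/

/-- The sets of letters whose numbers of occurrences are counted in the abelianization. -/
def axis : Fin 4 → Finset Gen := ![{.x}, {.y}, {.d, .b}, {.c, .d}]

/-- The generators of the abelianization, dual to `axis`. -/
def dual : Fin 4 → Gen := ![.x, .y, .b, .c]

/-- The parities of the numbers of occurrences of the letters belonging to the sets `axis i`. -/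
def parity : FreeGroup Gen →* Multiplicative (Fin 4 → ZMod 2) :=
  FreeGroup.lift fun h => Multiplicative.ofAdd fun i => if h ∈ axis i then 1 else 0

theorem parity_apply (f : FreeGroup Gen) (i : Fin 4) :
    (parity f).toAdd i = (count (axis i) f).toAdd := by
  have e : (AddMonoidHom.toMultiplicative (Pi.evalAddMonoidHom (fun _ : Fin 4 => ZMod 2) i)).comp
      parity = count (axis i) := by
    ext h : 1
    rw [count_of]
    simp [parity]
  rw [← e]
  rfl

theorem symSeq_axis_mem (h : ∀ z : Letter, ∀ N : ℕ, ∃ n, N ≤ n ∧ (α n).Uses z) (i : Fin 4) :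
    symSeq α (axis i) ∈ shift α := by
  fin_cases i
  · exact symSeq_letter_mem (h .x)
  · exact symSeq_letter_mem (h .y)
  · exact symSeq_conn_mem (i := 2) fun k => by
      unfold conn
      rw [if_neg (by omega), if_pos (by omega)]
      rfl
  · exact symSeq_conn_mem (i := 0) fun k => by
      unfold conn
      rw [if_neg (by omega), if_neg (by omega)]
      rfl

theorem parity_eq_one (h : ∀ z : Letter, ∀ N : ℕ, ∃ n, N ≤ n ∧ (α n).Uses z) {f : FreeGroup Gen}
    (hf : toG α f = 1) : parity f = 1 := by
  apply Multiplicative.toAdd.injective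
  funext i
  rw [parity_apply, count_eq_one (symSeq_axis_mem h i) hf]
  rfl

/-- The homomorphism from the free group onto the abelianization. -/
noncomputable def toAb (α : ℕ → Symb) : FreeGroup Gen →* Abelianization (G α) :=
  Abelianization.of.comp (toG α)

theorem toAb_surjective : Function.Surjective (toAb α) :=
  (QuotientGroup.mk'_surjective _).comp toG_surjective

theorem toAb_eq_one_iff {f : FreeGroup Gen} : toAb α f = 1 ↔ toG α f ∈ commutator (G α) :=
  QuotientGroup.eq_one_iff _

/-- The homomorphism mapping the basis to the classes of the generators `x`, `y`, `b`, `c`. -/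
noncomputable def fromParity (α : ℕ → Symb) :
    Multiplicative (Fin 4 → ZMod 2) →* Abelianization (G α) where
  toFun v := ∏ i, toAb α (FreeGroup.of (dual i)) ^ (v.toAdd i).val
  map_one' := by simp
  map_mul' u v := by
    rw [← Finset.prod_mul_distrib]
    refine Finset.prod_congr rfl fun i _ => ?_
    have hz : toAb α (FreeGroup.of (dual i)) ^ 2 = 1 := by
      rw [pow_two, ← map_mul, toAb, MonoidHom.comp_apply, toG_of_mul_self, map_one]
    rw [toAdd_mul, Pi.add_apply]
    generalize u.toAdd i = a
    generalize v.toAdd i = b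
    rw [ZMod.val_add, ← pow_add]
    exact (pow_eq_pow_mod _ hz).symm

theorem toAb_of_mul_self (h : Gen) : toAb α (FreeGroup.of h) * toAb α (FreeGroup.of h) = 1 := by
  rw [← map_mul, toAb, MonoidHom.comp_apply, toG_of_mul_self, map_one]

theorem toAb_of_eq_one {a : Gen} (ha : a ∈ aSet) : toAb α (FreeGroup.of a) = 1 :=
  toAb_eq_one_iff.mpr (toG_of_mem_commutator ha)

theorem toAb_d :
    toAb α (FreeGroup.of .d) = toAb α (FreeGroup.of .b) * toAb α (FreeGroup.of .c) := by
  have h : toAb α (FreeGroup.of .b * FreeGroup.of .c * FreeGroup.of .d) = 1 := by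
    rw [toAb, MonoidHom.comp_apply, toG_bcd, map_one]
  rw [map_mul, map_mul] at h
  rw [eq_inv_of_mul_eq_one_left h, ← mul_eq_one_iff_eq_inv, toAb_of_mul_self]

theorem fromParity_parity (f : FreeGroup Gen) : fromParity α (parity f) = toAb α f := by
  have e : (fromParity α).comp parity = toAb α := by
    ext h
    simp only [MonoidHom.comp_apply, fromParity, MonoidHom.coe_mk, OneHom.coe_mk, parity,
      FreeGroup.lift_apply_of, toAdd_ofAdd, Fin.prod_univ_four]
    cases h
    case a0 => simpa [axis, dual] using (toAb_of_eq_one (by decide)).symm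
    case a1 => simpa [axis, dual] using (toAb_of_eq_one (by decide)).symm
    case a2 => simpa [axis, dual] using (toAb_of_eq_one (by decide)).symm
    case d => rw [toAb_d]; simp [axis, dual, ZMod.val_one]
    all_goals simp [axis, dual, ZMod.val_one]
  exact DFunLike.congr_fun e f

theorem fromParity_surjective : Function.Surjective (fromParity α) := fun z => by
  obtain ⟨f, rfl⟩ := toAb_surjective z
  exact ⟨parity f, fromParity_parity f⟩

theorem finiteIndex_commutator (α : ℕ → Symb) : (commutator (G α)).FiniteIndex := by
  have : Finite (G α ⧸ commutator (G α)) := Finite.of_surjective _ (fromParity_surjective (α := α))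
  exact Subgroup.finiteIndex_of_finite_quotient

theorem map_toG_commutator : (commutator (FreeGroup Gen)).map (toG α) = commutator (G α) := by
  rw [commutator_def, Subgroup.map_commutator, commutator_def, ← MonoidHom.range_eq_map,
    MonoidHom.range_eq_top.mpr toG_surjective]

theorem fromParity_injective (h : ∀ z : Letter, ∀ N : ℕ, ∃ n, N ≤ n ∧ (α n).Uses z) :
    Function.Injective (fromParity α) := by
  rw [injective_iff_map_eq_one]
  intro v hv
  obtain ⟨f, rfl⟩ : ∃ f, parity f = v := by
    refine ⟨(List.ofFn fun i => FreeGroup.of (dual i) ^ (v.toAdd i).val).prod, ?_⟩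
    apply Multiplicative.toAdd.injective
    funext j
    rw [map_list_prod]
    fin_cases j <;>
      simp [parity, axis, dual, List.ofFn_succ, -ZMod.natCast_val, ZMod.natCast_zmod_val]
  rw [fromParity_parity, toAb_eq_one_iff, ← map_toG_commutator] at hv
  obtain ⟨u, hu, huf⟩ := hv
  have h1 : parity u = 1 := Abelianization.commutator_subset_ker parity hu
  have h2 : parity (f * u⁻¹) = 1 := parity_eq_one h (by rw [map_mul, map_inv, huf, mul_inv_cancel])
  rwa [map_mul, map_inv, h1, inv_one, mul_one] at h2

/-! ### Simplicity of the derived subgroup -/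

/-- The group is not abelian: near the axis of a symmetric sequence the labels are `{b, c}`, `a_0`,
`a_2`, hence `a_0` and `a_2` do not commute on the vertex `1`. -/
theorem toG_commutator_ne_one :
    toG α ⁅FreeGroup.of Gen.a0, FreeGroup.of Gen.a2⁆ ≠ 1 := by
  intro h
  rw [map_commutatorElement, commutatorElement_eq_one_iff_mul_comm, ← map_mul, ← map_mul] at h
  have hw : symSeq α {.b, .c} ∈ shift α := symSeq_conn_mem (i := 1) fun k => by
    unfold conn
    rw [if_pos (by omega)]
  have hd := shift_disj hw
  set w := symSeq α {.b, .c} with hwd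
  have h0 : w 0 = {.b, .c} := symSeq_zero _
  have h1 : w 1 = {.a0} :=
    symSeq_eq_std (α := α) {.b, .c} 0 (p := 0) le_rfl (by simp [len, blk, IJ])
  have h2 : w 2 = {.a2} :=
    symSeq_eq_std (α := α) {.b, .c} 0 (p := 1) (by norm_num) (by simp [len, blk, IJ])
  have e := DFunLike.congr_fun (congrArg Subtype.val h) (⟨w, hw⟩, (1 : ℤ))
  rw [toG_apply, toG_apply] at e
  simp only [map_mul, Perm.mul_apply, rho_of hd, Prod.mk.injEq, true_and] at e
  rw [step_of_notMem (h := Gen.a2) (n := 1) (by simp [h1]) (by simp [h0]),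
    step_of_mem (h := Gen.a0) (n := 1) (by simp [h1]), show (1 : ℤ) + 1 = 2 by norm_num,
    step_of_mem (h := Gen.a2) (n := 2) (by simp [h2])] at e
  omega

theorem isSimpleGroup_commutator (α : ℕ → Symb) : IsSimpleGroup (commutator (G α)) := by
  have hne : Nontrivial (commutator (G α)) := by
    rw [Subgroup.nontrivial_iff_ne_bot]
    intro h
    have hm : toG α ⁅FreeGroup.of Gen.a0, FreeGroup.of Gen.a2⁆ ∈ commutator (G α) := by
      rw [map_commutatorElement]
      exact Subgroup.commutator_mem_commutator (Subgroup.mem_top _) (Subgroup.mem_top _)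
    rw [h, Subgroup.mem_bot] at hm
    exact toG_commutator_ne_one hm
  refine { hne with
    eq_bot_or_eq_top_of_normal := fun N hN => or_iff_not_imp_left.mpr fun hbot => ?_ }
  obtain ⟨⟨z, hzN⟩, hz⟩ := Subgroup.ne_bot_iff_exists_ne_one.mp hbot
  have hz1 : z ≠ 1 := fun h => hz (Subtype.ext h)
  obtain ⟨f, hf⟩ := toG_surjective z.1
  have hle := commutator_le_of_normal (α := α)
    (M := (N.map (commutator (G α)).subtype).comap (toG α)) (f := f)
    (fun v hv => by rw [Subgroup.mem_comap, hv]; exact Subgroup.one_mem _) ?_ ?_ ?_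
  · rw [← Subgroup.map_le_iff_le_comap, map_toG_commutator] at hle
    refine eq_top_iff.mpr fun u _ => ?_
    obtain ⟨v, hv, hvu⟩ := hle u.2
    rwa [← Subtype.ext (a1 := v) (a2 := u) hvu]
  · intro g hg v ⟨u, hu, huv⟩
    have hg' : toG α g ∈ commutator (G α) := by
      rw [← map_toG_commutator]
      exact ⟨g, hg, rfl⟩
    refine ⟨⟨_, hg'⟩ * u * ⟨_, hg'⟩⁻¹, hN.conj_mem u hu _, ?_⟩
    simp only [map_mul, map_inv, huv]
    rfl
  · exact ⟨z, hzN, hf.symm⟩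
  · rw [hf]
    exact fun h => hz1 (Subtype.ext h)

end AlphaGroup

theorem mainTheorem4 (α : ℕ → AlphaGroup.Symb) :
    IsSimpleGroup (commutator (AlphaGroup.G α)) ∧
    (commutator (AlphaGroup.G α)).FiniteIndex ∧
    ((∀ z : AlphaGroup.Letter, ∀ N : ℕ, ∃ n, N ≤ n ∧ (α n).Uses z) →
      Nonempty ((AlphaGroup.G α ⧸ commutator (AlphaGroup.G α)) ≃*
        Multiplicative (Fin 4 → ZMod 2))) :=
  ⟨AlphaGroup.isSimpleGroup_commutator α, AlphaGroup.finiteIndex_commutator α, fun h =>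
    ⟨(MulEquiv.ofBijective (AlphaGroup.fromParity α)
      ⟨AlphaGroup.fromParity_injective h, AlphaGroup.fromParity_surjective⟩).symm⟩⟩
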